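/- Let $M$ be a complete (connected, finite-dimensional, smooth, boundaryless) Riemannian manifold with Riemannian distance function $d \colon M \times M \to \mathbb{R}$, and for $p \in M$ write $d_p(q) = d(p,q)$. Let $k \ge 1$, read the indices $i \in \{1,\dots,k\}$ cyclically modulo $k$ (so $x_0 = x_k$ and $x_{k+1} = x_1$), and define the uniform energy $E \colon M^k \to \mathbb{R}$ by $$E(x_1,\dots,x_k) = \sum_{i=1}^k \frac{d(x_i,x_{i+1})^2}{1/k}.$$ A point $\bar x \in M^k$ is called a critical point of the uniform energy if $E$ is differentiable at $\bar x$ and its gradient there, with respect to the product Riemannian metric, is zero: $\nabla E(\bar x) = \vec 0$. Theorem. Let $\bar x = (x_1,\dots,x_k) \in M^k$ be a point of nonzero energy, $E(\bar x) \neq 0$ (that is, the points $x_1,\dots,x_k$ are not all equal). Then $\bar x$ is a critical point of the uniform energy if and only if, for every $i \in \{1,\dots,k\}$, $$d(x_{i-1},x_i) = d(x_i,x_{i+1}),$$ and the functions $d_{x_{i-1}}$ and $d_{x_{i+1}}$ are both differentiable at $x_i$ with $$\nabla d_{x_{i-1}}(x_i) = -\nabla d_{x_{i+1}}(x_i).$$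 -/

import Mathlib

open Bundle
open scoped Manifold ContDiff

noncomputable section

/-- The vector `v` is the gradient at `p` of the real-valued function `f` on a Riemannian manifold:
`f` is differentiable at `p`, and its differential there is `w ↦ ⟪v, w⟫`. -/
def HasRiemannianGradientAt
    {E : Type*} [NormedAddCommGroup E] [NormedSpace ℝ E]
    {M : Type*} [TopologicalSpace M] [ChartedSpace E M]
    [RiemannianBundle (fun p : M => TangentSpace 𝓘(ℝ, E) p)]
    (f : M → ℝ) (p : M) (v : TangentSpace 𝓘(ℝ, E) p) : Prop :=
  MDifferentiableAt 𝓘(ℝ, E) 𝓘(ℝ, ℝ) f p ∧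
    ∀ w : TangentSpace 𝓘(ℝ, E) p, (inner ℝ v w : ℝ) = mfderiv 𝓘(ℝ, E) 𝓘(ℝ, ℝ) f p w

/-- The vector `v = (v₁, …, v_k)` is the gradient at `x` of the real-valued function `f` on the
product manifold `M ^ k`, which carries the product Riemannian metric
`⟪v, w⟫ = ∑ i, ⟪v i, w i⟫` on `T_x (M ^ k) = ∏ i, T_{x i} M`. -/
def HasProductGradientAt
    {E : Type*} [NormedAddCommGroup E] [NormedSpace ℝ E]
    {M : Type*} [TopologicalSpace M] [ChartedSpace E M]
    [RiemannianBundle (fun p : M => TangentSpace 𝓘(ℝ, E) p)] {k : ℕ}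
    (f : (Fin k → M) → ℝ) (x : Fin k → M) (v : (i : Fin k) → TangentSpace 𝓘(ℝ, E) (x i)) : Prop :=
  MDifferentiableAt (ModelWithCorners.pi fun _ : Fin k => 𝓘(ℝ, E)) 𝓘(ℝ, ℝ) f x ∧
    ∀ w : (i : Fin k) → TangentSpace 𝓘(ℝ, E) (x i),
      (∑ i, inner ℝ (v i) (w i) : ℝ) =
        mfderiv (ModelWithCorners.pi fun _ : Fin k => 𝓘(ℝ, E)) 𝓘(ℝ, ℝ) f x w

/-- The uniform energy `E(x) = ∑ i, d(x_i, x_{i+1})² / (1/k)`; the indices are cyclic, since addition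
in `Fin k` is modulo `k`. -/
def uniformEnergy {M : Type*} [MetricSpace M] {k : ℕ} [NeZero k] (x : Fin k → M) : ℝ :=
  ∑ i : Fin k, dist (x i) (x (i + 1)) ^ 2 / (1 / (k : ℝ))

/-- `x` is a critical point of the uniform energy: the uniform energy is differentiable at `x`
and its gradient there is zero. -/
def IsCriticalPointOfUniformEnergy
    (E : Type*) [NormedAddCommGroup E] [NormedSpace ℝ E]
    {M : Type*} [MetricSpace M] [ChartedSpace E M]
    [RiemannianBundle (fun p : M => TangentSpace 𝓘(ℝ, E) p)] {k : ℕ} [NeZero k]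
    (x : Fin k → M) : Prop :=
  HasProductGradientAt (E := E) uniformEnergy x 0

end

/-!
The proof rests on the semiconcavity of the distance; it uses neither geodesics nor the exponential
map.

*Semiconcavity.* Fix `q` and a cutoff function `φ` in the chart at `q`. The maps which translate a
point `y` of the chart by `± φ y • h` are self-maps of `M`, and the squared norms of the images of
a tangent vector `v` under their derivatives add up to at most `(2 + C ‖h‖²) ‖v‖²`, because the
metric is twice differentiable. Applied to almost minimizing paths from `m` to `y`, where `m` is
fixed by both maps, this gives `d(m, y + h) + d(m, y - h) ≤ (2 + C ‖h‖²) d(m, y)`, uniformly in `m`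
(`exists_dist_add_dist_le`). Splitting a path in the middle gives joint semiconcavity of the
distance near a pair of distinct points (`midpointSemiconcaveAt_dist`).

*Critical points satisfy the conditions.* With all points but `xᵢ` fixed, the energy is, up to
constants, the sum of the squared distances to `xᵢ₋₁` and `xᵢ₊₁`. By semiconcavity each
of the two functions is touched from above at `xᵢ` by a differentiable function
(`exists_hasUpperSupport_dist_sq`). If two functions with this property have a differentiable sum,
both are differentiable (`HasUpperSupport.hasFDerivAt_of_add`). The two derivatives are opposite,
and since the differential of a distance function has norm one wherever it exists
(`abs_apply_le_of_hasFDerivAt_dist`, `one_le_of_hasFDerivAt_dist`), the two distances agree. Hence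
all consecutive distances agree; they are not zero because the energy is not, and the
distance functions themselves are differentiable with opposite gradients.

*Converse.* A jointly semiconcave function of two variables which is differentiable in each variable
separately is differentiable (`MidpointSemiconcaveAt.hasFDerivAt_of_partial`), so each summand of
the energy is differentiable, and the terms of the derivative of the sum cancel in pairs.
-/

section

open Set Filter Topology Metric MeasureTheory Manifold

/-! ### Semiconcave functions on normed spaces -/

section Semiconcave

variable {V W : Type*} [NormedAddCommGroup V] [NormedAddCommGroup W]

/-- Midpoint semiconcavity near `z`: up to a quadratic error with a uniform constant, the value of
`f` at the middle of a short segment near `z` is at least the mean of the values at its ends. -/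
def MidpointSemiconcaveAt (f : V → ℝ) (z : V) : Prop :=
  ∃ C : ℝ, ∃ δ > 0, ∀ y ∈ ball z δ, ∀ h : V, ‖h‖ < δ →
    f (y + h) + f (y - h) ≤ 2 * f y + C * ‖h‖ ^ 2

lemma MidpointSemiconcaveAt.exists_nonneg {f : V → ℝ} {z : V} (hf : MidpointSemiconcaveAt f z) :
    ∃ C : ℝ, 0 ≤ C ∧ ∃ δ > 0, ∀ y ∈ ball z δ, ∀ h : V, ‖h‖ < δ →
      f (y + h) + f (y - h) ≤ 2 * f y + C * ‖h‖ ^ 2 := by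
  obtain ⟨C, δ, hδ, hC⟩ := hf
  refine ⟨|C|, abs_nonneg _, δ, hδ, fun y hy h hh => (hC y hy h hh).trans ?_⟩
  gcongr
  exact le_abs_self C

variable [NormedSpace ℝ V] [NormedSpace ℝ W]

/-- `L` is the derivative at `z` of a function which touches `f` from above at `z`. -/
def HasUpperSupport (f : V → ℝ) (L : V →L[ℝ] ℝ) (z : V) : Prop :=
  ∃ φ : V → ℝ, HasFDerivAt φ L z ∧ φ z = f z ∧ ∀ᶠ y in 𝓝 z, f y ≤ φ y

lemma HasFDerivAt.of_squeeze {f φ ψ : V → ℝ} {L : V →L[ℝ] ℝ} {z : V}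
    (hφ : HasFDerivAt φ L z) (hψ : HasFDerivAt ψ L z) (hφz : φ z = f z) (hψz : ψ z = f z)
    (hf : ∀ᶠ y in 𝓝 z, ψ y ≤ f y ∧ f y ≤ φ y) : HasFDerivAt f L z := by
  rw [hasFDerivAt_iff_isLittleO, Asymptotics.isLittleO_iff] at *
  intro c hc
  filter_upwards [hφ hc, hψ hc, hf] with y h1 h2 h3
  rw [Real.norm_eq_abs, abs_le] at *
  constructor <;> linarith [h1.1, h1.2, h2.1, h2.2, h3.1, h3.2]

/-- Two functions with upper supports whose sum is differentiable are both differentiable. -/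
lemma HasUpperSupport.hasFDerivAt_of_add {f g : V → ℝ} {L L' S : V →L[ℝ] ℝ} {z : V}
    (hf : HasUpperSupport f L z) (hg : HasUpperSupport g L' z)
    (hS : HasFDerivAt (fun y => f y + g y) S z) :
    HasFDerivAt f L z ∧ HasFDerivAt g L' z ∧ L + L' = S := by
  obtain ⟨φ, hφ, hφz, hfφ⟩ := hf
  obtain ⟨ψ, hψ, hψz, hgψ⟩ := hg
  -- the difference of the two sides is minimal at `z`
  have hmin : IsLocalMin (fun y => (φ y + ψ y) - (f y + g y)) z := by
    filter_upwards [hfφ, hgψ] with y h1 h2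
    simp only [hφz, hψz]
    linarith
  have hzero := hmin.hasFDerivAt_eq_zero ((hφ.add hψ).sub hS)
  have hSL : L + L' = S := sub_eq_zero.mp hzero
  refine ⟨?_, ?_, hSL⟩
  · refine HasFDerivAt.of_squeeze (ψ := fun y => (f y + g y) - ψ y) hφ ?_ hφz (by simp [hψz]) ?_
    · have := hS.sub hψ
      rwa [← hSL, add_sub_cancel_right] at this
    · filter_upwards [hfφ, hgψ] with y h1 h2
      exact ⟨by linarith, h1⟩
  · refine HasFDerivAt.of_squeeze (ψ := fun y => (f y + g y) - φ y) hψ ?_ hψz (by simp [hφz]) ?_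
    · have := hS.sub hφ
      rwa [← hSL, add_sub_cancel_left] at this
    · filter_upwards [hfφ, hgψ] with y h1 h2
      exact ⟨by linarith, h2⟩

lemma HasFDerivAt.real_sq {f : V → ℝ} {L : V →L[ℝ] ℝ} {z : V} (hf : HasFDerivAt f L z) :
    HasFDerivAt (fun y => f y ^ 2) ((2 * f z) • L) z := by
  simpa using hf.pow 2

lemma HasUpperSupport.sq {f : V → ℝ} {L : V →L[ℝ] ℝ} {z : V} (hf : HasUpperSupport f L z)
    (hpos : ∀ y, 0 ≤ f y) : HasUpperSupport (fun y => f y ^ 2) ((2 * f z) • L) z := by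
  obtain ⟨φ, hφ, hφz, hfφ⟩ := hf
  refine ⟨fun y => φ y ^ 2, ?_, by simp [hφz], ?_⟩
  · rw [← hφz]
    exact hφ.real_sq
  · filter_upwards [hfφ] with y hy
    exact pow_le_pow_left₀ (hpos y) hy 2

/-- A midpoint semiconcave function is bounded above, near a point where it is differentiable, by
its affine approximation plus a quadratic term; the constant and the radius are uniform. -/
lemma le_affine_add_of_midpoint {f : V → ℝ} {y : V} {C δ : ℝ} (hC : 0 ≤ C) {L : V →L[ℝ] ℝ}
    {z : V} (hz : ∀ y ∈ ball z δ, ∀ h : V, ‖h‖ < δ →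
      f (y + h) + f (y - h) ≤ 2 * f y + C * ‖h‖ ^ 2)
    (hL : HasFDerivAt f L y) {h : V} (hy : ‖y - z‖ + ‖h‖ < δ) :
    f (y + h) ≤ f y + L h + C * ‖h‖ ^ 2 := by
  -- the dyadic difference quotients increase, up to an error that sums to a quadratic one
  have key : ∀ n : ℕ, f (y + h) - f y ≤
      2 ^ n * (f (y + (2⁻¹ ^ n : ℝ) • h) - f y) + C * ‖h‖ ^ 2 * (1 - 2⁻¹ ^ n) := by
    intro n
    induction n with
    | zero => simp
    | succ n ih =>
      set s : ℝ := 2⁻¹ ^ n with hs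
      have hs0 : 0 < s := by positivity
      have hs1 : s ≤ 1 := pow_le_one₀ (by norm_num) (by norm_num)
      have h2s : (2 : ℝ) ^ n * s = 1 := by
        rw [hs, ← mul_pow]; norm_num
      have hsucc : (2⁻¹ : ℝ) ^ (n + 1) = s / 2 := by rw [pow_succ, ← hs]; ring
      have hnorm : ‖(s / 2) • h‖ = s / 2 * ‖h‖ := by
        rw [norm_smul, Real.norm_of_nonneg (by positivity)]
      have hle : s / 2 * ‖h‖ ≤ ‖h‖ := by nlinarith [norm_nonneg h]
      have hmid := hz (y + (s / 2) • h) (by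
        rw [mem_ball, dist_eq_norm]
        calc ‖y + (s / 2) • h - z‖ = ‖(y - z) + (s / 2) • h‖ := by congr 1; abel
          _ ≤ ‖y - z‖ + ‖(s / 2) • h‖ := norm_add_le _ _
          _ < δ := by rw [hnorm]; linarith) ((s / 2) • h)
        (by rw [hnorm]; linarith [norm_nonneg (y - z)])
      rw [add_sub_cancel_right, add_assoc, ← add_smul, add_halves, hnorm] at hmid
      rw [hsucc, pow_succ]
      have h3 : (2 : ℝ) ^ n * (f (y + s • h) - f y) ≤
          2 ^ n * (2 * (f (y + (s / 2) • h) - f y) + C * (s / 2 * ‖h‖) ^ 2) := by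
        gcongr
        linarith
      have h4 : (2 : ℝ) ^ n * (C * (s / 2 * ‖h‖) ^ 2) = C * ‖h‖ ^ 2 * (s / 4) := by
        calc (2 : ℝ) ^ n * (C * (s / 2 * ‖h‖) ^ 2)
            = (2 ^ n * s) * (C * ‖h‖ ^ 2 * (s / 4)) := by ring
          _ = _ := by rw [h2s, one_mul]
      have h5 : 0 ≤ C * ‖h‖ ^ 2 * s := by positivity
      nlinarith
  have hlim : Tendsto (fun n : ℕ => (2 : ℝ) ^ n * (f (y + (2⁻¹ ^ n : ℝ) • h) - f y)) atTop
      (𝓝 (L h)) := by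
    have h0 : Tendsto (fun n : ℕ => (2⁻¹ : ℝ) ^ n) atTop (𝓝[>] 0) := by
      refine tendsto_nhdsWithin_iff.mpr ⟨tendsto_pow_atTop_nhds_zero_of_lt_one (by norm_num)
        (by norm_num), Eventually.of_forall fun n => ?_⟩
      simp
    have := (hL.hasLineDerivAt h).tendsto_slope_zero_right.comp h0
    refine this.congr fun n => ?_
    simp [smul_eq_mul]
  have hbound : ∀ n : ℕ, f (y + h) - f y - C * ‖h‖ ^ 2 ≤
      2 ^ n * (f (y + (2⁻¹ ^ n : ℝ) • h) - f y) := by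
    intro n
    have h6 : 0 ≤ C * ‖h‖ ^ 2 * (2⁻¹ : ℝ) ^ n := by positivity
    linarith [key n]
  linarith [ge_of_tendsto' hlim hbound]

/-- A locally Lipschitz midpoint semiconcave function has an upper support. By Rademacher's theorem
it is differentiable at points converging to `z`; a limit of the derivatives there is the
derivative of an upper support at `z`. -/
lemma MidpointSemiconcaveAt.exists_hasUpperSupport [FiniteDimensional ℝ V] {f : V → ℝ} {z : V}
    (hf : MidpointSemiconcaveAt f z) {K : NNReal} {s : Set V} (hs : s ∈ 𝓝 z)
    (hLip : LipschitzOnWith K f s) : ∃ L : V →L[ℝ] ℝ, HasUpperSupport f L z := by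
  obtain ⟨C, hC, δ, hδ, hz⟩ := hf.exists_nonneg
  let _ : MeasurableSpace V := borel V
  have _ : BorelSpace V := ⟨rfl⟩
  have hdense : Dense {x | x ∈ s → DifferentiableWithinAt ℝ f s x} :=
    Measure.dense_of_ae (hLip.ae_differentiableWithinAt_of_mem
      (μ := Measure.addHaar))
  obtain ⟨u, hu, hlim⟩ := mem_closure_iff_seq_limit.mp (hdense z)
  have hsi : interior s ∈ 𝓝 z := interior_mem_nhds.mpr hs
  have hdiff : ∀ᶠ n in atTop, HasFDerivAt f (fderiv ℝ f (u n)) (u n) ∧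
      ‖fderiv ℝ f (u n)‖ ≤ K := by
    filter_upwards [hlim hsi] with n hn
    have hnhds : s ∈ 𝓝 (u n) := mem_interior_iff_mem_nhds.mp hn
    have hd : DifferentiableAt ℝ f (u n) :=
      (hu n (mem_of_mem_nhds hnhds)).differentiableAt hnhds
    exact ⟨hd.hasFDerivAt, hd.hasFDerivAt.le_of_lipschitzOn hnhds hLip⟩
  obtain ⟨L, -, θ, hθ, hL⟩ := (isCompact_closedBall (0 : V →L[ℝ] ℝ) K).tendsto_subseq'
    (x := fun n => fderiv ℝ f (u n)) (hdiff.mono fun n hn => by simpa using hn.2).frequently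
  have hcont : ContinuousAt f z := hLip.continuousOn.continuousAt hs
  have huθ : Tendsto (u ∘ θ) atTop (𝓝 z) := hlim.comp hθ.tendsto_atTop
  refine ⟨L, fun y => f z + L (y - z) + C * ‖y - z‖ ^ 2, ?_, by simp, ?_⟩
  · rw [hasFDerivAt_iff_isLittleO_nhds_zero]
    have : (fun h : V => ‖h‖ ^ 2) =o[𝓝 0] fun h => h :=
      Asymptotics.isLittleO_norm_pow_id one_lt_two
    refine (this.const_mul_left C).congr_left fun h => ?_
    simp only [add_sub_cancel_left, sub_self, map_zero, norm_zero]
    ring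
  · filter_upwards [ball_mem_nhds z (half_pos hδ), interior_mem_nhds.mpr hs] with y hy hys
    have hL' : Tendsto (fun n => fderiv ℝ f (u (θ n))) atTop (𝓝 L) := hL
    have hy' : ‖y - z‖ < δ / 2 := by rwa [← dist_eq_norm]
    have hsub : Tendsto (fun n => y - u (θ n)) atTop (𝓝 (y - z)) := huθ.const_sub y
    have hright : Tendsto (fun n => f (u (θ n)) + fderiv ℝ f (u (θ n)) (y - u (θ n)) +
        C * ‖y - u (θ n)‖ ^ 2) atTop (𝓝 (f z + L (y - z) + C * ‖y - z‖ ^ 2)) :=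
      ((hcont.tendsto.comp huθ).add
        (((isBoundedBilinearMap_apply (𝕜 := ℝ) (E := V) (F := ℝ)).continuous.tendsto
          (L, y - z)).comp (hL'.prodMk_nhds hsub))).add ((hsub.norm.pow 2).const_mul C)
    refine ge_of_tendsto hright ?_
    have hnear : Tendsto (fun n => ‖u (θ n) - z‖ + ‖y - u (θ n)‖) atTop
        (𝓝 (‖z - z‖ + ‖y - z‖)) := (huθ.sub_const z).norm.add hsub.norm
    have hlt : ‖z - z‖ + ‖y - z‖ < δ := by simp; linarith
    filter_upwards [hnear (Iio_mem_nhds hlt), hθ.tendsto_atTop.eventually hdiff] with n hn hd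
    have := le_affine_add_of_midpoint hC hz hd.1 (h := y - u (θ n)) hn
    simpa using this

/-- A midpoint semiconcave function on a product which is differentiable in each of the two
variables separately is differentiable. The lower bound at `z + (a, b)` comes from semiconcavity on
the segment from `z + (2 • a, 0)` to `z + (0, 2 • b)`, and the upper bound from the lower bound at
`z - (a, b)`. -/
lemma MidpointSemiconcaveAt.hasFDerivAt_of_partial {D : V × W → ℝ} {z : V × W}
    (hD : MidpointSemiconcaveAt D z) {L : V →L[ℝ] ℝ} {L' : W →L[ℝ] ℝ}
    (hL : HasFDerivAt (fun u => D (u, z.2)) L z.1)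
    (hL' : HasFDerivAt (fun v => D (z.1, v)) L' z.2) :
    HasFDerivAt D (L.coprod L') z := by
  obtain ⟨C, hC, δ, hδ, hz⟩ := hD.exists_nonneg
  rw [hasFDerivAt_iff_isLittleO_nhds_zero, Asymptotics.isLittleO_iff] at *
  have lower : ∀ c > 0, ∀ᶠ h : V × W in 𝓝 0,
      -c * ‖h‖ ≤ D (z + h) - D z - L.coprod L' h := by
    intro c hc
    have hfst : Tendsto (fun h : V × W => (2 : ℝ) • h.1) (𝓝 0) (𝓝 0) :=
      Continuous.tendsto' (by fun_prop) _ _ (by simp)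
    have hsnd : Tendsto (fun h : V × W => (2 : ℝ) • h.2) (𝓝 0) (𝓝 0) :=
      Continuous.tendsto' (by fun_prop) _ _ (by simp)
    have hCsmall : ∀ᶠ h : V × W in 𝓝 0, C * ‖h‖ < c / 2 := by
      have : Tendsto (fun h : V × W => C * ‖h‖) (𝓝 0) (𝓝 0) :=
        Continuous.tendsto' (by fun_prop) _ _ (by simp)
      exact this (Iio_mem_nhds (half_pos hc))
    have hc8 : 0 < c / 8 := by positivity
    filter_upwards [hfst.eventually (hL hc8), hsnd.eventually (hL' hc8), hCsmall,
      ball_mem_nhds (0 : V × W) hδ] with h h1 h2 h3 h4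
    have h4' : ‖h‖ < δ := by simpa using h4
    have hmid := hz (z + h) (by simpa [dist_eq_norm] using h4') (h.1, -h.2)
      (by simpa [Prod.norm_def] using h4')
    have e1 : z + h + (h.1, -h.2) = (z.1 + (2 : ℝ) • h.1, z.2) := by
      ext <;> simp [two_smul, add_assoc]
    have e2 : z + h - (h.1, -h.2) = (z.1, z.2 + (2 : ℝ) • h.2) := by
      ext <;> simp [two_smul, add_assoc]
    have e3 : ‖((h.1, -h.2) : V × W)‖ = ‖h‖ := by simp [Prod.norm_def]
    rw [e1, e2, e3] at hmid
    rw [Real.norm_eq_abs, abs_le, norm_smul, map_smul, smul_eq_mul] at h1 h2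
    have n1 := norm_fst_le h
    have n2 := norm_snd_le h
    rw [Real.norm_ofNat] at h1 h2
    have h5 : C * ‖h‖ ^ 2 ≤ c / 2 * ‖h‖ := by nlinarith [norm_nonneg h]
    rw [ContinuousLinearMap.coprod_apply]
    have hzz : D (z.1, z.2) = D z := rfl
    rw [hzz] at h1 h2
    have hcn1 : c * ‖h.1‖ ≤ c * ‖h‖ := by gcongr
    have hcn2 : c * ‖h.2‖ ≤ c * ‖h‖ := by gcongr
    linarith [h1.1, h2.1]
  intro c hc
  have hc2 : 0 < c / 2 := by positivity
  have hneg : Tendsto (fun h : V × W => -h) (𝓝 0) (𝓝 0) :=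
    Continuous.tendsto' (by fun_prop) _ _ (by simp)
  have hCsmall : ∀ᶠ h : V × W in 𝓝 0, C * ‖h‖ < c / 2 := by
    have : Tendsto (fun h : V × W => C * ‖h‖) (𝓝 0) (𝓝 0) :=
      Continuous.tendsto' (by fun_prop) _ _ (by simp)
    exact this (Iio_mem_nhds (half_pos hc))
  filter_upwards [lower c hc, hneg.eventually (lower (c / 2) hc2), hCsmall,
    ball_mem_nhds (0 : V × W) hδ] with h h1 h2 h3 h4
  have hmid := hz z (mem_ball_self hδ) h (by simpa using h4)
  rw [Real.norm_eq_abs, abs_le]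
  refine ⟨by linarith, ?_⟩
  rw [norm_neg, map_neg, ← sub_eq_add_neg] at h2
  nlinarith [norm_nonneg h]

/-- Second order estimates for a `C²` function, uniform near a point. -/
lemma ContDiffAt.exists_second_difference_le {f : V → W} {z : V} (hf : ContDiffAt ℝ 2 f z) :
    ∃ C : ℝ, 0 ≤ C ∧ ∃ δ > 0, ∀ y ∈ ball z δ, ∀ k : V, ‖k‖ < δ →
      ‖f (y + k)‖ ≤ C ∧ ‖f (y + k) - f (y - k)‖ ≤ C * ‖k‖ ∧
      ‖f (y + k) + f (y - k) - (2 : ℝ) • f y‖ ≤ C * ‖k‖ ^ 2 := by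
  have hf' : ContDiffAt ℝ 1 (fderiv ℝ f) z := hf.fderiv_right (by norm_num)
  obtain ⟨K, t, ht, hK⟩ := hf'.exists_lipschitzOnWith
  obtain ⟨K', t', ht', hK'⟩ := (hf.of_le one_le_two).exists_lipschitzOnWith
  have hdiff : ∀ᶠ y in 𝓝 z, DifferentiableAt ℝ f y :=
    (hf.eventually (by simp)).mono fun y hy => hy.differentiableAt (by norm_num)
  have hbdd : ∀ᶠ y in 𝓝 z, ‖f y‖ < ‖f z‖ + 1 :=
    hf.continuousAt.norm (Iio_mem_nhds (by linarith))
  obtain ⟨ε, hε, hball⟩ := Metric.mem_nhds_iff.mp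
    (inter_mem (inter_mem ht ht') (inter_mem hdiff hbdd))
  refine ⟨(‖f z‖ + 1) + 2 * K' + 2 * K, by positivity, ε / 2, by positivity, ?_⟩
  intro y hy k hk
  have hy' : ‖y - z‖ < ε / 2 := by rwa [← dist_eq_norm]
  have hmem : ∀ s ∈ Icc (-1 : ℝ) 1, y + s • k ∈ ball z ε := by
    intro s hs
    rw [mem_ball, dist_eq_norm]
    calc ‖y + s • k - z‖ = ‖(y - z) + s • k‖ := by congr 1; abel
      _ ≤ ‖y - z‖ + |s| * ‖k‖ := (norm_add_le _ _).trans (by rw [norm_smul, Real.norm_eq_abs])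
      _ ≤ ‖y - z‖ + 1 * ‖k‖ := by gcongr; exact abs_le.mpr hs
      _ < ε := by linarith
  have hp := hmem 1 (by simp)
  have hm := hmem (-1) (by simp)
  rw [one_smul] at hp
  rw [neg_one_smul, ← sub_eq_add_neg] at hm
  have hk0 := norm_nonneg k
  have hz0 := norm_nonneg (f z)
  have hK0 : (0 : ℝ) ≤ K := K.2
  have hK0' : (0 : ℝ) ≤ K' := K'.2
  refine ⟨(hball hp).2.2.le.trans (by linarith), ?_, ?_⟩
  · have := hK'.dist_le_mul _ (hball hp).1.2 _ (hball hm).1.2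
    rw [dist_eq_norm, dist_eq_norm, show y + k - (y - k) = (2 : ℝ) • k by
      rw [two_smul]; abel, norm_smul, Real.norm_ofNat] at this
    refine this.trans ?_
    nlinarith
  · -- the derivative of `s ↦ f (y + s • k) + f (y - s • k)` is at most `2 K ‖k‖²`
    have hder : ∀ s ∈ Icc (0 : ℝ) 1, HasDerivWithinAt
        (fun s : ℝ => f (y + s • k) + f (y + (-s) • k))
        (fderiv ℝ f (y + s • k) k + fderiv ℝ f (y + (-s) • k) (-k)) (Icc 0 1) s := by
      intro s hs
      have d1 := (hball (hmem s ⟨by linarith [hs.1], hs.2⟩)).2.1.hasFDerivAt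
      have d2 := (hball (hmem (-s) ⟨by linarith [hs.2], by linarith [hs.1]⟩)).2.1.hasFDerivAt
      have l1 : HasDerivAt (fun s : ℝ => y + s • k) k s := by
        simpa using ((hasDerivAt_id s).smul_const k).const_add y
      have l2 : HasDerivAt (fun s : ℝ => y + (-s) • k) (-k) s := by
        simpa using ((hasDerivAt_neg s).smul_const k).const_add y
      exact ((d1.comp_hasDerivAt s l1).add (d2.comp_hasDerivAt s l2)).hasDerivWithinAt
    have hbound : ∀ s ∈ Ico (0 : ℝ) 1,
        ‖fderiv ℝ f (y + s • k) k + fderiv ℝ f (y + (-s) • k) (-k)‖ ≤ 2 * K * ‖k‖ ^ 2 := by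
      intro s hs
      have m1 := hball (hmem s ⟨by linarith [hs.1], hs.2.le⟩)
      have m2 := hball (hmem (-s) ⟨by linarith [hs.2], by linarith [hs.1]⟩)
      have := hK.dist_le_mul _ m1.1.1 _ m2.1.1
      rw [dist_eq_norm, dist_eq_norm, show y + s • k - (y + (-s) • k) = (2 * s) • k by
        rw [two_mul, add_smul, neg_smul]; abel, norm_smul, Real.norm_of_nonneg
        (by linarith [hs.1])] at this
      rw [map_neg, ← sub_eq_add_neg, ← sub_apply]
      refine (ContinuousLinearMap.le_opNorm _ _).trans ?_
      have hs1 : 2 * s * ‖k‖ ≤ 2 * ‖k‖ := by nlinarith [hs.2]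
      calc _ ≤ (K * (2 * s * ‖k‖)) * ‖k‖ := by gcongr
        _ ≤ (K * (2 * ‖k‖)) * ‖k‖ := by gcongr
        _ = 2 * K * ‖k‖ ^ 2 := by ring
    have := norm_image_sub_le_of_norm_deriv_le_segment' hder hbound 1 (by simp)
    simp only [one_smul, neg_smul, zero_smul, add_zero, neg_zero, sub_zero, mul_one,
      ← sub_eq_add_neg] at this
    rw [← two_smul ℝ (f y)] at this
    refine this.trans ?_
    gcongr
    linarith

end Semiconcave

variable {E : Type*} [NormedAddCommGroup E] [NormedSpace ℝ E]

/-! ### The metric in a chart -/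

section ChartMetric

variable {M : Type*} [TopologicalSpace M] [ChartedSpace E M]

/-- The derivative at `y` of the inverse of the preferred chart at `q`. -/
noncomputable def chartSymmDeriv (q : M) (y : E) :
    E →L[ℝ] TangentSpace 𝓘(ℝ, E) ((extChartAt 𝓘(ℝ, E) q).symm y) :=
  mfderiv 𝓘(ℝ, E) 𝓘(ℝ, E) (extChartAt 𝓘(ℝ, E) q).symm y

variable [IsManifold 𝓘(ℝ, E) ∞ M] in
lemma hasMFDerivAt_chart_symm (q : M) {y : E} (hy : y ∈ (extChartAt 𝓘(ℝ, E) q).target) :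
    HasMFDerivAt 𝓘(ℝ, E) 𝓘(ℝ, E) (extChartAt 𝓘(ℝ, E) q).symm y (chartSymmDeriv q y) := by
  have := mdifferentiableWithinAt_extChartAt_symm (I := 𝓘(ℝ, E)) hy
  rw [modelWithCornersSelf_coe, range_id, mdifferentiableWithinAt_univ] at this
  exact this.hasMFDerivAt

variable [IsManifold 𝓘(ℝ, E) ∞ M] in
lemma mfderiv_chart_chartSymmDeriv (q : M) {y : E} (hy : y ∈ (extChartAt 𝓘(ℝ, E) q).target)
    (w : E) :
    mfderiv 𝓘(ℝ, E) 𝓘(ℝ, E) (extChartAt 𝓘(ℝ, E) q) ((extChartAt 𝓘(ℝ, E) q).symm y)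
      (chartSymmDeriv q y w) = w := by
  have h1 := hasMFDerivAt_chart_symm q hy
  have h2 : HasMFDerivAt 𝓘(ℝ, E) 𝓘(ℝ, E) (extChartAt 𝓘(ℝ, E) q)
      ((extChartAt 𝓘(ℝ, E) q).symm y) (mfderiv 𝓘(ℝ, E) 𝓘(ℝ, E) (extChartAt 𝓘(ℝ, E) q)
      ((extChartAt 𝓘(ℝ, E) q).symm y)) := by
    refine (mdifferentiableAt_extChartAt ?_).hasMFDerivAt
    simpa using (extChartAt 𝓘(ℝ, E) q).map_target hy
  have h3 := h2.comp y h1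
  have h4 : HasMFDerivAt 𝓘(ℝ, E) 𝓘(ℝ, E)
      (extChartAt 𝓘(ℝ, E) q ∘ (extChartAt 𝓘(ℝ, E) q).symm) y
      (ContinuousLinearMap.id ℝ (TangentSpace 𝓘(ℝ, E) y)) := by
    refine (hasMFDerivAt_id y).congr_of_eventuallyEq ?_
    filter_upwards [(isOpen_extChartAt_target q).mem_nhds hy] with z hz
    exact (extChartAt 𝓘(ℝ, E) q).right_inv hz
  exact congr($(hasMFDerivAt_unique h3 h4) w)

variable [RiemannianBundle (fun p : M => TangentSpace 𝓘(ℝ, E) p)]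

/-- The Riemannian metric read in the preferred chart at `q`, as a bilinear form on `E` depending
on the point of the chart. -/
noncomputable def chartMetric (q : M) (y : E) : E →L[ℝ] E →L[ℝ] ℝ :=
  (innerSL ℝ).bilinearComp (chartSymmDeriv q y) (chartSymmDeriv q y)

lemma chartMetric_apply (q : M) (y w w' : E) :
    chartMetric q y w w' = inner ℝ (chartSymmDeriv q y w) (chartSymmDeriv q y w') := rfl

lemma chartMetric_self (q : M) (y w : E) :
    chartMetric q y w w = ‖chartSymmDeriv q y w‖ ^ 2 := by
  rw [chartMetric_apply, real_inner_self_eq_norm_sq]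

variable [IsManifold 𝓘(ℝ, E) ∞ M]

/-- The derivatives of a chart and of its inverse are inverse to each other. The statement compares
norms because the two vectors are tangent at points that are equal only propositionally. -/
lemma norm_chartSymmDeriv_mfderiv_chart (q : M) {x : M} (hx : x ∈ (extChartAt 𝓘(ℝ, E) q).source)
    (v : TangentSpace 𝓘(ℝ, E) x) :
    ‖chartSymmDeriv q (extChartAt 𝓘(ℝ, E) q x)
      (mfderiv 𝓘(ℝ, E) 𝓘(ℝ, E) (extChartAt 𝓘(ℝ, E) q) x v)‖ = ‖v‖ := by
  have h1 := hasMFDerivAt_chart_symm q ((extChartAt 𝓘(ℝ, E) q).map_source hx)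
  have h2 : HasMFDerivAt 𝓘(ℝ, E) 𝓘(ℝ, E) (extChartAt 𝓘(ℝ, E) q) x
      (mfderiv 𝓘(ℝ, E) 𝓘(ℝ, E) (extChartAt 𝓘(ℝ, E) q) x) := by
    refine (mdifferentiableAt_extChartAt ?_).hasMFDerivAt
    simpa using hx
  have h3 := h1.comp x h2
  have h4 : HasMFDerivAt 𝓘(ℝ, E) 𝓘(ℝ, E)
      ((extChartAt 𝓘(ℝ, E) q).symm ∘ extChartAt 𝓘(ℝ, E) q) x
      (ContinuousLinearMap.id ℝ (TangentSpace 𝓘(ℝ, E) x)) := by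
    refine (hasMFDerivAt_id x).congr_of_eventuallyEq ?_
    filter_upwards [(isOpen_extChartAt_source q).mem_nhds hx] with z hz
    exact (extChartAt 𝓘(ℝ, E) q).left_inv hz
  have h5 := congr($(hasMFDerivAt_unique h3 h4) v)
  -- the two vectors agree in `E`, and the points at which they are tangent agree too
  have h6 : ∀ (x' : M) (_ : x' = x) (u : TangentSpace 𝓘(ℝ, E) x'), (show E from u) = v →
      ‖u‖ = ‖v‖ := by
    rintro x' rfl u hu
    exact congrArg _ hu
  exact h6 _ ((extChartAt 𝓘(ℝ, E) q).left_inv hx) _ h5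

variable [IsContMDiffRiemannianBundle 𝓘(ℝ, E) ∞ E (fun p : M => TangentSpace 𝓘(ℝ, E) p)]

variable (E M) in
lemma isContinuousRiemannianBundle_tangentSpace :
    IsContinuousRiemannianBundle E (fun p : M => TangentSpace 𝓘(ℝ, E) p) := by
  obtain ⟨g, hg, hinner⟩ := IsContMDiffRiemannianBundle.exists_contMDiff (IB := 𝓘(ℝ, E)) (n := ∞)
    (F := E) (E := fun p : M => TangentSpace 𝓘(ℝ, E) p)
  exact ⟨g, hg.continuous, hinner⟩

lemma contDiffOn_chartMetric [FiniteDimensional ℝ E] (q : M) :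
    ContDiffOn ℝ 2 (chartMetric q) (extChartAt 𝓘(ℝ, E) q).target := by
  simp_rw [contDiffOn_clm_apply]
  intro w w'
  have hT : ∀ w : E, ContMDiffOn 𝓘(ℝ, E) (𝓘(ℝ, E).prod 𝓘(ℝ, E)) 2
      (fun y : E => (⟨(extChartAt 𝓘(ℝ, E) q).symm y, chartSymmDeriv q y w⟩ :
        TangentBundle 𝓘(ℝ, E) M))
      (extChartAt 𝓘(ℝ, E) q).target := by
    intro w
    have h1 : ContMDiffOn 𝓘(ℝ, E) 𝓘(ℝ, E) 3 (extChartAt 𝓘(ℝ, E) q).symm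
        (extChartAt 𝓘(ℝ, E) q).target :=
      (contMDiffOn_extChartAt_symm (n := ∞) q).of_le ENat.LEInfty.out
    have hopen := isOpen_extChartAt_target (I := 𝓘(ℝ, E)) q
    have h2 := h1.contMDiffOn_tangentMapWithin (m := 2) (by norm_num) hopen.uniqueMDiffOn
    have h3 : ContMDiffOn 𝓘(ℝ, E) (𝓘(ℝ, E).prod 𝓘(ℝ, E)) 2
        (fun y : E => (⟨y, w⟩ : TangentBundle 𝓘(ℝ, E) E)) (extChartAt 𝓘(ℝ, E) q).target := by
      intro y hy
      rw [contMDiffWithinAt_totalSpace]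
      refine ⟨contMDiffWithinAt_id, ?_⟩
      simp only [trivializationAt_model_space_apply]
      exact contMDiffWithinAt_const
    refine (h2.comp h3 fun y hy => hy).congr fun y hy => ?_
    simp only [Function.comp, tangentMapWithin]
    rw [mfderivWithin_of_isOpen hopen hy]
    rfl
  rw [← contMDiffOn_iff_contDiffOn]
  exact ContMDiffOn.inner_bundle (E := fun p : M => TangentSpace 𝓘(ℝ, E) p)
    (b := (extChartAt 𝓘(ℝ, E) q).symm) (v := fun y => chartSymmDeriv q y w)
    (w := fun y => chartSymmDeriv q y w')
    (hT w) (hT w')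

lemma eventually_norm_le_chartSymmDeriv (q : M) :
    ∃ C > 0, ∀ᶠ y in 𝓝 (extChartAt 𝓘(ℝ, E) q q), ∀ w : E, ‖w‖ ≤ C * ‖chartSymmDeriv q y w‖ := by
  have := isContinuousRiemannianBundle_tangentSpace E M
  rcases eventually_norm_trivializationAt_lt E (fun p : M ↦ TangentSpace 𝓘(ℝ, E) p) q
    with ⟨C, C_pos, hC⟩
  refine ⟨C, C_pos, ?_⟩
  have hcont := continuousAt_extChartAt_symm (I := 𝓘(ℝ, E)) q
  rw [ContinuousAt, extChartAt_to_inv] at hcont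
  filter_upwards [hcont.eventually hC, extChartAt_target_mem_nhds q] with y hy hyt w
  have hs := (extChartAt 𝓘(ℝ, E) q).map_target hyt
  rw [extChartAt_source] at hs
  calc ‖w‖ = ‖(trivializationAt E (fun p : M ↦ TangentSpace 𝓘(ℝ, E) p) q).continuousLinearMapAt ℝ
        ((extChartAt 𝓘(ℝ, E) q).symm y) (chartSymmDeriv q y w)‖ := by
        rw [TangentBundle.continuousLinearMapAt_trivializationAt hs]
        exact congrArg norm (mfderiv_chart_chartSymmDeriv q hyt w).symm
    _ ≤ _ := (ContinuousLinearMap.le_opNorm _ _).trans (by gcongr)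

end ChartMetric

/-! ### Lengths of paths and distances -/

section Distance

variable {M : Type*} [MetricSpace M] [ChartedSpace E M]
  [RiemannianBundle (fun p : M => TangentSpace 𝓘(ℝ, E) p)] [IsRiemannianManifold 𝓘(ℝ, E) M]

variable (E) in
lemma exists_path_of_dist_lt {p q : M} {r : ℝ} (hr : dist p q < r) :
    ∃ γ : ℝ → M, γ 0 = p ∧ γ 1 = q ∧ ContMDiff 𝓘(ℝ, ℝ) 𝓘(ℝ, E) 1 γ ∧
      pathELength 𝓘(ℝ, E) γ 0 1 < ENNReal.ofReal r := by
  have h : riemannianEDist 𝓘(ℝ, E) p q < ENNReal.ofReal r := by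
    rw [← IsRiemannianManifold.out (I := 𝓘(ℝ, E)), edist_dist]
    exact (ENNReal.ofReal_lt_ofReal_iff_of_nonneg dist_nonneg).mpr hr
  obtain ⟨γ, h0, h1, hγ, hlen, -⟩ := exists_lt_locally_constant_of_riemannianEDist_lt h zero_lt_one
  exact ⟨γ, h0, h1, hγ, hlen⟩

lemma edist_le_pathELength {γ : ℝ → M} {a b : ℝ} (hab : a ≤ b)
    (hγ : ContMDiffOn 𝓘(ℝ, ℝ) 𝓘(ℝ, E) 1 γ (Icc a b)) :
    edist (γ a) (γ b) ≤ pathELength 𝓘(ℝ, E) γ a b := by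
  rw [IsRiemannianManifold.out (I := 𝓘(ℝ, E))]
  exact riemannianEDist_le_pathELength hγ rfl rfl hab

variable (E) in
include E in
/-- At every intermediate distance from `p` there is a point that lies, up
to `ε`, between `p` and `q`. -/
lemma exists_almost_between (p q : M) {s ε : ℝ} (hs : 0 ≤ s) (hsd : s ≤ dist p q) (hε : 0 < ε) :
    ∃ m : M, dist p m = s ∧ dist m q ≤ dist p q - s + ε := by
  obtain ⟨γ, rfl, rfl, hγ, hlen⟩ := exists_path_of_dist_lt E (p := p) (q := q)
    (r := dist p q + ε) (by linarith)
  have hcont : Continuous fun t => dist (γ 0) (γ t) := by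
    have := hγ.continuous
    fun_prop
  obtain ⟨t, ht, hts⟩ := intermediate_value_Icc (zero_le_one' ℝ) hcont.continuousOn
    (show s ∈ Icc (dist (γ 0) (γ 0)) (dist (γ 0) (γ 1)) by simpa using ⟨hs, hsd⟩)
  refine ⟨γ t, hts, ?_⟩
  have h1 := edist_le_pathELength ht.1 (hγ.contMDiffOn (s := Icc 0 t))
  have h2 := edist_le_pathELength ht.2 (hγ.contMDiffOn (s := Icc t 1))
  have h3 := (add_le_add h1 h2).trans_lt ((pathELength_add ht.1 ht.2).trans_lt hlen)
  rw [edist_dist, edist_dist, ← ENNReal.ofReal_add dist_nonneg dist_nonneg,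
    ENNReal.ofReal_lt_ofReal_iff_of_nonneg (by positivity)] at h3
  simp only at hts
  linarith

/-- If two `C¹` self-maps together stretch tangent vectors by a factor of at most `c`, then they
together stretch distances by a factor of at most `c`. -/
lemma dist_add_dist_le_of_norm_mfderiv_add_le {F G : M → M}
    (hF : ContMDiff 𝓘(ℝ, E) 𝓘(ℝ, E) 1 F) (hG : ContMDiff 𝓘(ℝ, E) 𝓘(ℝ, E) 1 G) {c : ℝ} (hc : 0 ≤ c)
    (h : ∀ (x : M) (v : TangentSpace 𝓘(ℝ, E) x), ‖mfderiv 𝓘(ℝ, E) 𝓘(ℝ, E) F x v‖ +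
      ‖mfderiv 𝓘(ℝ, E) 𝓘(ℝ, E) G x v‖ ≤ c * ‖v‖) (p q : M) :
    dist (F p) (F q) + dist (G p) (G q) ≤ c * dist p q := by
  have key : ∀ r > dist p q, dist (F p) (F q) + dist (G p) (G q) ≤ c * r := by
    intro r hr
    have hr0 : 0 ≤ r := dist_nonneg.trans hr.le
    obtain ⟨γ, rfl, rfl, hγ, hlen⟩ := exists_path_of_dist_lt E hr
    have h1 := edist_le_pathELength (zero_le_one' ℝ) ((hF.comp hγ).contMDiffOn (s := Icc 0 1))
    have h2 := edist_le_pathELength (zero_le_one' ℝ) ((hG.comp hγ).contMDiffOn (s := Icc 0 1))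
    have h3 : pathELength 𝓘(ℝ, E) (F ∘ γ) 0 1 + pathELength 𝓘(ℝ, E) (G ∘ γ) 0 1 ≤
        ENNReal.ofReal c * pathELength 𝓘(ℝ, E) γ 0 1 := by
      simp only [pathELength_eq_lintegral_mfderiv_Icc]
      rw [← lintegral_const_mul' _ _ ENNReal.ofReal_ne_top]
      refine (le_lintegral_add _ _).trans (lintegral_mono fun t => ?_)
      have hγt := hγ.mdifferentiable one_ne_zero t
      rw [mfderiv_comp t (hF.mdifferentiable one_ne_zero _) hγt,
        mfderiv_comp t (hG.mdifferentiable one_ne_zero _) hγt]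
      have := h (γ t) (mfderiv 𝓘(ℝ, ℝ) 𝓘(ℝ, E) γ t 1)
      have := ENNReal.ofReal_le_ofReal this
      rw [ENNReal.ofReal_add (norm_nonneg _) (norm_nonneg _), ENNReal.ofReal_mul hc,
        ofReal_norm, ofReal_norm, ofReal_norm] at this
      exact this
    have h4 := (add_le_add h1 h2).trans (h3.trans (mul_le_mul_right hlen.le _))
    simp only [Function.comp_apply] at h4
    rw [edist_dist, edist_dist, ← ENNReal.ofReal_add dist_nonneg dist_nonneg,
      ← ENNReal.ofReal_mul hc, ENNReal.ofReal_le_ofReal_iff (by positivity)] at h4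
    exact h4
  refine ge_of_tendsto (x := 𝓝[>] (dist p q)) (f := fun r => c * r)
    ((continuous_const_mul c).tendsto _ |>.mono_left nhdsWithin_le_nhds) ?_
  filter_upwards [self_mem_nhdsWithin] with r hr using key r hr

variable [IsManifold 𝓘(ℝ, E) ∞ M]

/-- The distance between the ends of a segment in a chart is at most its maximal speed. -/
lemma dist_chart_symm_le (q : M) {u v : E} {K : ℝ}
    (hseg : segment ℝ u v ⊆ (extChartAt 𝓘(ℝ, E) q).target)
    (hK : ∀ y ∈ segment ℝ u v, ‖chartSymmDeriv q y (v - u)‖ ≤ K) :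
    dist ((extChartAt 𝓘(ℝ, E) q).symm u) ((extChartAt 𝓘(ℝ, E) q).symm v) ≤ K := by
  let η := ContinuousAffineMap.lineMap (R := ℝ) u v
  have hη : ∀ t ∈ Icc (0 : ℝ) 1, η t ∈ segment ℝ u v := by
    intro t ht
    rw [segment_eq_image_lineMap]
    exact ⟨t, ht, rfl⟩
  have hη0 : η 0 = u := by simp [η, ContinuousAffineMap.coe_lineMap_eq]
  have hη1 : η 1 = v := by simp [η, ContinuousAffineMap.coe_lineMap_eq]
  have hsmooth : ContMDiffOn 𝓘(ℝ, ℝ) 𝓘(ℝ, E) 1 ((extChartAt 𝓘(ℝ, E) q).symm ∘ η) (Icc 0 1) :=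
    (contMDiffOn_extChartAt_symm q).comp
      ((contMDiff_iff_contDiff.mpr η.contDiff).contMDiffOn (s := Icc 0 1))
      fun t ht => hseg (hη t ht)
  have hK0 : 0 ≤ K := (norm_nonneg _).trans (hK u (left_mem_segment ℝ u v))
  have h1 := edist_le_pathELength (zero_le_one' ℝ) hsmooth
  have h2 : pathELength 𝓘(ℝ, E) ((extChartAt 𝓘(ℝ, E) q).symm ∘ η) 0 1 ≤ ENNReal.ofReal K := by
    rw [pathELength_eq_lintegral_mfderiv_Icc]
    have : ENNReal.ofReal K = ∫⁻ _ in Icc (0 : ℝ) 1, ENNReal.ofReal K := by simp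
    rw [this]
    refine setLIntegral_mono' measurableSet_Icc fun t ht => ?_
    have hd : HasDerivAt η (v - u) t := by
      simpa [η, ContinuousAffineMap.coe_lineMap_eq] using
        (AffineMap.hasDerivAt_lineMap (a := u) (b := v) (x := t))
    have hcomp := (hasMFDerivAt_chart_symm q (hseg (hη t ht))).comp t
      hd.hasFDerivAt.hasMFDerivAt
    rw [hcomp.mfderiv]
    have := ENNReal.ofReal_le_ofReal (hK _ (hη t ht))
    rw [ofReal_norm] at this
    exact (congrArg (fun w : E => ‖chartSymmDeriv q (η t) w‖ₑ) (one_smul ℝ (v - u))).trans_le this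
  have h3 := h1.trans h2
  simp only [Function.comp_apply, hη0, hη1] at h3
  rwa [edist_dist, ENNReal.ofReal_le_ofReal_iff hK0] at h3

/-- A linear map that is bounded by `c` times the Riemannian norm near the base point of a
chart is `c`-Lipschitz at this point for the Riemannian distance. -/
lemma eventually_norm_chart_sub_le {F : Type*} [NormedAddCommGroup F] [NormedSpace ℝ F]
    (q : M) (l : E →L[ℝ] F) {c : ℝ} (hc : 0 ≤ c)
    (hl : ∀ᶠ y in 𝓝 (extChartAt 𝓘(ℝ, E) q q), ∀ w, ‖l w‖ ≤ c * ‖chartSymmDeriv q y w‖) :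
    ∀ᶠ x in 𝓝 q, ‖l (extChartAt 𝓘(ℝ, E) q x) - l (extChartAt 𝓘(ℝ, E) q q)‖ ≤ c * dist q x := by
  obtain ⟨ρ, hρ, hball⟩ := Metric.mem_nhds_iff.mp (inter_mem (extChartAt_source_mem_nhds
    (I := 𝓘(ℝ, E)) q) ((continuousAt_extChartAt (I := 𝓘(ℝ, E)) q).eventually hl))
  filter_upwards [ball_mem_nhds q hρ] with x hx
  rw [mem_ball, dist_comm] at hx
  have key : ∀ r, dist q x < r → r < ρ →
      ‖l (extChartAt 𝓘(ℝ, E) q x) - l (extChartAt 𝓘(ℝ, E) q q)‖ ≤ c * r := by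
    intro r hr hrρ
    have hr0 : 0 ≤ r := dist_nonneg.trans hr.le
    obtain ⟨γ, h0, h1, hγ, hlen⟩ := exists_path_of_dist_lt E hr
    -- a path shorter than `ρ` does not leave the ball of radius `ρ`
    have hstay : ∀ t ∈ Icc (0 : ℝ) 1, γ t ∈ ball q ρ := by
      intro t ht
      have h2 := (edist_le_pathELength ht.1 (hγ.contMDiffOn (s := Icc 0 t))).trans
        (pathELength_mono le_rfl ht.2)
      have h3 := h2.trans_lt hlen
      rw [h0, edist_dist, ENNReal.ofReal_lt_ofReal_iff_of_nonneg dist_nonneg] at h3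
      rw [mem_ball, dist_comm]
      exact h3.trans hrρ
    let f : ℝ → F := fun t => l (extChartAt 𝓘(ℝ, E) q (γ t))
    have hder : ∀ t ∈ Icc (0 : ℝ) 1, HasMFDerivAt 𝓘(ℝ, ℝ) 𝓘(ℝ, F) f t
        ((l : E →L[ℝ] F) ∘L (mfderiv 𝓘(ℝ, E) 𝓘(ℝ, E) (extChartAt 𝓘(ℝ, E) q) (γ t)) ∘L
          (mfderiv 𝓘(ℝ, ℝ) 𝓘(ℝ, E) γ t)) := by
      intro t ht
      have hd1 : MDifferentiableAt 𝓘(ℝ, E) 𝓘(ℝ, E) (extChartAt 𝓘(ℝ, E) q) (γ t) :=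
        mdifferentiableAt_extChartAt (by simpa using (hball (hstay t ht)).1)
      have hd2 := hγ.mdifferentiable one_ne_zero t
      exact (l.hasFDerivAt.hasMFDerivAt).comp t (hd1.hasMFDerivAt.comp t hd2.hasMFDerivAt)
    have hsm : ContDiffOn ℝ 1 f (Icc 0 1) := by
      rw [← contMDiffOn_iff_contDiffOn]
      refine l.contMDiff.comp_contMDiffOn ?_
      exact (contMDiffOn_extChartAt (I := 𝓘(ℝ, E)) (n := 1) (x := q)).comp
        (hγ.contMDiffOn (s := Icc 0 1)) fun t ht => by
          simpa using (hball (hstay t ht)).1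
    have hint := enorm_sub_le_lintegral_derivWithin_Icc_of_contDiffOn_Icc hsm zero_le_one
    have hle : ∫⁻ t in Icc (0 : ℝ) 1, ‖derivWithin f (Icc 0 1) t‖ₑ ≤
        ENNReal.ofReal c * pathELength 𝓘(ℝ, E) γ 0 1 := by
      rw [pathELength_eq_lintegral_mfderiv_Icc, ← lintegral_const_mul' _ _ ENNReal.ofReal_ne_top]
      refine setLIntegral_mono' measurableSet_Icc fun t ht => ?_
      have hft : HasFDerivAt f (_ : ℝ →L[ℝ] F) t := (hder t ht).hasFDerivAt
      replace hft := hft.hasDerivAt.hasDerivWithinAt (s := Icc 0 1)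
      rw [hft.derivWithin (uniqueDiffOn_Icc zero_lt_one t ht)]
      obtain ⟨hs, hl⟩ := hball (hstay t ht)
      have h4 := hl (mfderiv 𝓘(ℝ, E) 𝓘(ℝ, E) (extChartAt 𝓘(ℝ, E) q) (γ t)
        (mfderiv 𝓘(ℝ, ℝ) 𝓘(ℝ, E) γ t 1))
      rw [norm_chartSymmDeriv_mfderiv_chart q hs] at h4
      have h5 := ENNReal.ofReal_le_ofReal h4
      rw [ENNReal.ofReal_mul hc, ofReal_norm, ofReal_norm] at h5
      exact h5
    have h6 := hint.trans (hle.trans (mul_le_mul_right hlen.le _))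
    rw [← ENNReal.ofReal_mul hc, ← ofReal_norm,
      ENNReal.ofReal_le_ofReal_iff (by positivity)] at h6
    simpa [f, h0, h1] using h6
  refine ge_of_tendsto (x := 𝓝[>] (dist q x)) (f := fun r => c * r)
    ((continuous_const_mul c).tendsto _ |>.mono_left nhdsWithin_le_nhds) ?_
  filter_upwards [Ioo_mem_nhdsGT hx] with r hr using key r hr.1 hr.2

end Distance

/-! ### Pushing points along a chart -/

section ChartShift

/-- Second variation of the quadratic forms `gp`, `gm` of the metric at the points `y ± φ y • h`,
evaluated at the images `w ± t • h` of a vector `w` under the derivatives of the two shifts, where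
`t` is the derivative of `φ` along `w`. -/
lemma add_le_of_second_difference {gp gm g : E →L[ℝ] E →L[ℝ] ℝ} {C B t : ℝ} {h w : E}
    (hC : 0 ≤ C) (hB : 0 ≤ B) (hgp : ‖gp‖ ≤ C) (hgm : ‖gm‖ ≤ C) (h1 : ‖gp - gm‖ ≤ C * ‖h‖)
    (h2 : ‖gp + gm - (2 : ℝ) • g‖ ≤ C * ‖h‖ ^ 2) (ht : |t| ≤ B * ‖w‖) :
    gp (w + t • h) (w + t • h) + gm (w - t • h) (w - t • h) ≤
      2 * g w w + C * (1 + 2 * B + 2 * B ^ 2) * ‖h‖ ^ 2 * ‖w‖ ^ 2 := by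
  have hbil : ∀ (b : E →L[ℝ] E →L[ℝ] ℝ) {c : ℝ} (_ : ‖b‖ ≤ c) (u v : E),
      |b u v| ≤ c * ‖u‖ * ‖v‖ := by
    intro b c hb u v
    rw [← Real.norm_eq_abs]
    exact (b.le_opNorm₂ u v).trans (by gcongr)
  have e1 := hbil _ h2 w w
  have e2 := hbil _ h1 w h
  have e3 := hbil _ h1 h w
  have e4 := hbil _ hgp h h
  have e5 := hbil _ hgm h h
  simp only [sub_apply, add_apply, smul_apply, smul_eq_mul] at e1 e2 e3
  have hexp : gp (w + t • h) (w + t • h) + gm (w - t • h) (w - t • h) =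
      2 * g w w + (gp w w + gm w w - 2 * g w w) + t * (gp w h - gm w h) +
        t * (gp h w - gm h w) + t ^ 2 * (gp h h + gm h h) := by
    simp only [map_add, map_sub, map_smul, add_apply, sub_apply, smul_apply, smul_eq_mul]
    ring
  have f1 : t * (gp w h - gm w h) ≤ (B * ‖w‖) * (C * ‖h‖ * ‖w‖ * ‖h‖) :=
    (le_abs_self _).trans (by rw [abs_mul]; gcongr)
  have f2 : t * (gp h w - gm h w) ≤ (B * ‖w‖) * (C * ‖h‖ * ‖h‖ * ‖w‖) :=
    (le_abs_self _).trans (by rw [abs_mul]; gcongr)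
  have f3 : t ^ 2 * (gp h h + gm h h) ≤ (B * ‖w‖) ^ 2 * (2 * (C * ‖h‖ * ‖h‖)) := by
    rw [← sq_abs t]
    have : gp h h + gm h h ≤ 2 * (C * ‖h‖ * ‖h‖) := by
      linarith [le_abs_self (gp h h), le_abs_self (gm h h)]
    calc |t| ^ 2 * (gp h h + gm h h) ≤ |t| ^ 2 * (2 * (C * ‖h‖ * ‖h‖)) := by gcongr
      _ ≤ _ := by gcongr
  rw [hexp]
  linarith [le_abs_self (gp w w + gm w w - 2 * g w w)]

variable {M : Type*} [TopologicalSpace M] [ChartedSpace E M]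

open Classical in
/-- The self-map of `M` which, in the preferred chart at `q`, translates each point `y` by
`φ y • h`, and which is the identity outside of the domain of the chart. -/
noncomputable def chartShift (q : M) (φ : E → ℝ) (h : E) (x : M) : M :=
  if x ∈ (extChartAt 𝓘(ℝ, E) q).source then
    (extChartAt 𝓘(ℝ, E) q).symm (extChartAt 𝓘(ℝ, E) q x + φ (extChartAt 𝓘(ℝ, E) q x) • h)
  else x

lemma chartShift_of_mem {q : M} (φ : E → ℝ) (h : E) {x : M}
    (hx : x ∈ (extChartAt 𝓘(ℝ, E) q).source) :
    chartShift q φ h x =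
      (extChartAt 𝓘(ℝ, E) q).symm (extChartAt 𝓘(ℝ, E) q x + φ (extChartAt 𝓘(ℝ, E) q x) • h) :=
  if_pos hx

lemma chartShift_chart_symm {q : M} (φ : E → ℝ) (h : E) {y : E}
    (hy : y ∈ (extChartAt 𝓘(ℝ, E) q).target) :
    chartShift q φ h ((extChartAt 𝓘(ℝ, E) q).symm y) =
      (extChartAt 𝓘(ℝ, E) q).symm (y + φ y • h) := by
  rw [chartShift_of_mem φ h ((extChartAt 𝓘(ℝ, E) q).map_target hy),
    (extChartAt 𝓘(ℝ, E) q).right_inv hy]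

lemma chartShift_of_notMem {q : M} {φ : E → ℝ} {K : Set E} (hφ : ∀ y ∉ K, φ y = 0) (h : E) {x : M}
    (hx : x ∉ (extChartAt 𝓘(ℝ, E) q).symm '' K) : chartShift q φ h x = x := by
  by_cases hs : x ∈ (extChartAt 𝓘(ℝ, E) q).source
  · have : extChartAt 𝓘(ℝ, E) q x ∉ K := fun hK =>
      hx ⟨_, hK, (extChartAt 𝓘(ℝ, E) q).left_inv hs⟩
    rw [chartShift_of_mem φ h hs, hφ _ this, zero_smul, add_zero,
      (extChartAt 𝓘(ℝ, E) q).left_inv hs]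
  · exact if_neg hs

lemma isClosed_chart_symm_image [T2Space M] {q : M} {K : Set E} (hK : IsCompact K)
    (hKt : K ⊆ (extChartAt 𝓘(ℝ, E) q).target) :
    IsClosed ((extChartAt 𝓘(ℝ, E) q).symm '' K) :=
  (hK.image_of_continuousOn ((continuousOn_extChartAt_symm q).mono hKt)).isClosed

lemma chartShift_eventuallyEq_id [T2Space M] {q : M} {φ : E → ℝ} {K : Set E}
    (hφ : ∀ y ∉ K, φ y = 0) (hK : IsCompact K) (hKt : K ⊆ (extChartAt 𝓘(ℝ, E) q).target)
    (h : E) {x : M} (hx : x ∉ (extChartAt 𝓘(ℝ, E) q).symm '' K) :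
    chartShift q φ h =ᶠ[𝓝 x] id := by
  filter_upwards [(isClosed_chart_symm_image hK hKt).isOpen_compl.mem_nhds hx] with z hz
  exact chartShift_of_notMem hφ h hz

variable [IsManifold 𝓘(ℝ, E) ∞ M]

lemma contMDiff_chartShift [T2Space M] {q : M} {φ : E → ℝ} (hφ1 : ContDiff ℝ 1 φ) {K : Set E}
    (hφ : ∀ y ∉ K, φ y = 0) (hK : IsCompact K) (hKt : K ⊆ (extChartAt 𝓘(ℝ, E) q).target) {h : E}
    (hh : ∀ y ∈ K, y + φ y • h ∈ (extChartAt 𝓘(ℝ, E) q).target) :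
    ContMDiff 𝓘(ℝ, E) 𝓘(ℝ, E) 1 (chartShift q φ h) := by
  intro x
  by_cases hs : x ∈ (extChartAt 𝓘(ℝ, E) q).source
  · have heq : chartShift q φ h =ᶠ[𝓝 x] (extChartAt 𝓘(ℝ, E) q).symm ∘
        (fun y => y + φ y • h) ∘ extChartAt 𝓘(ℝ, E) q := by
      filter_upwards [(isOpen_extChartAt_source q).mem_nhds hs] with z hz
      exact chartShift_of_mem φ h hz
    refine ContMDiffAt.congr_of_eventuallyEq ?_ heq
    have hmem : extChartAt 𝓘(ℝ, E) q x + φ (extChartAt 𝓘(ℝ, E) q x) • h ∈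
        (extChartAt 𝓘(ℝ, E) q).target := by
      by_cases hxK : extChartAt 𝓘(ℝ, E) q x ∈ K
      · exact hh _ hxK
      · rw [hφ _ hxK, zero_smul, add_zero]
        exact (extChartAt 𝓘(ℝ, E) q).map_source hs
    have h1 : ContMDiffAt 𝓘(ℝ, E) 𝓘(ℝ, E) 1 (extChartAt 𝓘(ℝ, E) q) x :=
      contMDiffAt_extChartAt' (by simpa using hs)
    have h2 : ContMDiff 𝓘(ℝ, E) 𝓘(ℝ, E) 1 fun y => y + φ y • h :=
      ContDiff.contMDiff (by fun_prop)
    have h3 := (contMDiffOn_extChartAt_symm (I := 𝓘(ℝ, E)) (n := 1) q).contMDiffAt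
      ((isOpen_extChartAt_target q).mem_nhds hmem)
    exact h3.comp x (h2.contMDiffAt.comp x h1)
  · have hx : x ∉ (extChartAt 𝓘(ℝ, E) q).symm '' K := by
      rintro ⟨y, hy, rfl⟩
      exact hs ((extChartAt 𝓘(ℝ, E) q).map_target (hKt hy))
    exact contMDiffAt_id.congr_of_eventuallyEq (chartShift_eventuallyEq_id hφ hK hKt h hx)

variable [RiemannianBundle (fun p : M => TangentSpace 𝓘(ℝ, E) p)]

omit [IsManifold 𝓘(ℝ, E) ∞ M] in
/-- Tangent vectors at equal points that agree as elements of the model space have equal norms. -/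
lemma norm_tangentSpace_congr {p p' : M} (hp : p = p') {u : TangentSpace 𝓘(ℝ, E) p}
    {u' : TangentSpace 𝓘(ℝ, E) p'} (hu : (show E from u) = u') : ‖u‖ = ‖u'‖ := by
  subst hp
  exact congrArg _ hu

/-- The length of the image of a tangent vector under the derivative of a shift, read in the
chart. -/
lemma norm_mfderiv_chartShift {q : M} {φ : E → ℝ} (hφ1 : ContDiff ℝ 1 φ) {h : E} {x : M}
    (hs : x ∈ (extChartAt 𝓘(ℝ, E) q).source)
    (hmem : extChartAt 𝓘(ℝ, E) q x + φ (extChartAt 𝓘(ℝ, E) q x) • h ∈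
        (extChartAt 𝓘(ℝ, E) q).target) (v : TangentSpace 𝓘(ℝ, E) x) {w : E}
    (hw : w = mfderiv 𝓘(ℝ, E) 𝓘(ℝ, E) (extChartAt 𝓘(ℝ, E) q) x v) :
    ‖mfderiv 𝓘(ℝ, E) 𝓘(ℝ, E) (chartShift q φ h) x v‖ =
      ‖chartSymmDeriv q (extChartAt 𝓘(ℝ, E) q x + φ (extChartAt 𝓘(ℝ, E) q x) • h)
        (w + (fderiv ℝ φ (extChartAt 𝓘(ℝ, E) q x) w) • h)‖ := by
  have heq : chartShift q φ h =ᶠ[𝓝 x] (extChartAt 𝓘(ℝ, E) q).symm ∘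
      (fun y => y + φ y • h) ∘ extChartAt 𝓘(ℝ, E) q := by
    filter_upwards [(isOpen_extChartAt_source q).mem_nhds hs] with z hz
    exact chartShift_of_mem φ h hz
  have h1 : HasMFDerivAt 𝓘(ℝ, E) 𝓘(ℝ, E) (extChartAt 𝓘(ℝ, E) q) x
      (mfderiv 𝓘(ℝ, E) 𝓘(ℝ, E) (extChartAt 𝓘(ℝ, E) q) x) :=
    (mdifferentiableAt_extChartAt (by simpa using hs)).hasMFDerivAt
  have h2 : HasFDerivAt (fun y => y + φ y • h) (ContinuousLinearMap.id ℝ E +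
      (fderiv ℝ φ (extChartAt 𝓘(ℝ, E) q x)).smulRight h) (extChartAt 𝓘(ℝ, E) q x) :=
    (hasFDerivAt_id _).add
      (((hφ1.differentiable one_ne_zero).differentiableAt.hasFDerivAt).smul_const h)
  have h3 := (hasMFDerivAt_chart_symm q hmem).comp x (h2.hasMFDerivAt.comp x h1)
  have h4 := h3.congr_of_eventuallyEq heq
  rw [h4.mfderiv]
  refine norm_tangentSpace_congr (chartShift_of_mem φ h hs) ?_
  subst hw
  rfl

end ChartShift

/-! ### Semiconcavity of the distance to a point -/

section Semiconcavity

variable [FiniteDimensional ℝ E]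
variable {M : Type*} [MetricSpace M] [ChartedSpace E M] [IsManifold 𝓘(ℝ, E) ∞ M]
  [RiemannianBundle (fun p : M => TangentSpace 𝓘(ℝ, E) p)]
  [IsContMDiffRiemannianBundle 𝓘(ℝ, E) ∞ E (fun p : M => TangentSpace 𝓘(ℝ, E) p)]
  [IsRiemannianManifold 𝓘(ℝ, E) M]

/-- Semiconcavity of the distance to a point `m`, near a point `q ≠ m`, in a form that is uniform in
`m`. The two endpoints `y ± h` are reached by pushing almost minimizing paths from `m` to `y`
by the shifts by `± h`, which fix `m`; since the metric is twice differentiable, the lengths of the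
two new paths add up to twice the length of the original one, with a relative error of order
`‖h‖²`. -/
lemma exists_dist_add_dist_le (q : M) {r : ℝ} (hr : 0 < r) :
    ∃ C : ℝ, 0 ≤ C ∧ ∃ δ > 0, ∀ m : M, r ≤ dist m q →
      ∀ y ∈ ball (extChartAt 𝓘(ℝ, E) q q) δ, ∀ h : E, ‖h‖ < δ →
        dist m ((extChartAt 𝓘(ℝ, E) q).symm (y + h)) +
          dist m ((extChartAt 𝓘(ℝ, E) q).symm (y - h)) ≤
        (2 + C * ‖h‖ ^ 2) * dist m ((extChartAt 𝓘(ℝ, E) q).symm y) := by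
  set y₀ : E := extChartAt 𝓘(ℝ, E) q q with hy₀
  obtain ⟨A, hA, hAnorm⟩ := eventually_norm_le_chartSymmDeriv (E := E) q
  obtain ⟨C, hC, δ, hδ, hsecond⟩ := ((contDiffOn_chartMetric (E := E) q).contDiffAt
    (extChartAt_target_mem_nhds q)).exists_second_difference_le
  have hcont := continuousAt_extChartAt_symm (I := 𝓘(ℝ, E)) q
  rw [ContinuousAt, extChartAt_to_inv] at hcont
  obtain ⟨ρ, hρ, hball⟩ := Metric.mem_nhds_iff.mp (inter_mem (inter_mem hAnorm
    (extChartAt_target_mem_nhds q)) (inter_mem (ball_mem_nhds y₀ hδ)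
      (hcont (ball_mem_nhds q hr))))
  -- points up to distance `4 * R` from `y₀` are under control
  set R : ℝ := min (ρ / 4) δ with hR
  have hR0 : 0 < R := by positivity
  have hRρ : 4 * R ≤ ρ := by linarith [min_le_left (ρ / 4) δ]
  have hRδ : R ≤ δ := min_le_right _ _
  let φ : ContDiffBump y₀ := ⟨R, 2 * R, hR0, by linarith⟩
  have hφ1 : ContDiff ℝ 1 φ := φ.contDiff
  obtain ⟨B, hB⟩ := (φ.hasCompactSupport.fderiv (𝕜 := ℝ)).exists_bound_of_continuous
    (hφ1.continuous_fderiv one_ne_zero)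
  have hB0 : 0 ≤ B := (norm_nonneg _).trans (hB y₀)
  set K : Set E := closedBall y₀ (2 * R) with hKdef
  have hφK : ∀ y ∉ K, φ y = 0 := fun y hy =>
    φ.zero_of_le_dist (by simpa [hKdef, φ] using le_of_not_ge hy)
  have hK : IsCompact K := isCompact_closedBall _ _
  have hKsub : ∀ y ∈ K, y ∈ ball y₀ ρ := fun y hy => by
    rw [hKdef, mem_closedBall] at hy
    rw [mem_ball]
    linarith
  have hKt : K ⊆ (extChartAt 𝓘(ℝ, E) q).target := fun y hy => (hball (hKsub y hy)).1.2
  have hshift : ∀ h : E, ‖h‖ < R → ∀ y ∈ K, y + φ y • h ∈ (extChartAt 𝓘(ℝ, E) q).target := by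
    intro h hh y hy
    refine (hball ?_).1.2
    have : ‖φ y • h‖ ≤ ‖h‖ := by
      rw [norm_smul, Real.norm_of_nonneg φ.nonneg]
      exact mul_le_of_le_one_left (norm_nonneg _) φ.le_one
    rw [hKdef, mem_closedBall, dist_eq_norm] at hy
    rw [mem_ball, dist_eq_norm]
    calc ‖y + φ y • h - y₀‖ = ‖(y - y₀) + φ y • h‖ := by congr 1; abel
      _ ≤ ‖y - y₀‖ + ‖φ y • h‖ := norm_add_le _ _
      _ < ρ := by linarith
  set C' : ℝ := C * (1 + 2 * B + 2 * B ^ 2) * A ^ 2 with hC'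
  have hC'0 : 0 ≤ C' := by positivity
  refine ⟨C' / 2, by positivity, R, hR0, ?_⟩
  intro m hm y hy h hh
  have hh' : ‖-h‖ < R := by rwa [norm_neg]
  have hstretch : ∀ (x : M) (v : TangentSpace 𝓘(ℝ, E) x),
      ‖mfderiv 𝓘(ℝ, E) 𝓘(ℝ, E) (chartShift q φ h) x v‖ +
        ‖mfderiv 𝓘(ℝ, E) 𝓘(ℝ, E) (chartShift q φ (-h)) x v‖ ≤ (2 + C' / 2 * ‖h‖ ^ 2) * ‖v‖ := by
    intro x v
    by_cases hx : x ∈ (extChartAt 𝓘(ℝ, E) q).symm '' K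
    · obtain ⟨z, hz, rfl⟩ := hx
      have hs := (extChartAt 𝓘(ℝ, E) q).map_target (hKt hz)
      have hez := (extChartAt 𝓘(ℝ, E) q).right_inv (hKt hz)
      obtain ⟨w, hw⟩ : ∃ w : E, w = mfderiv 𝓘(ℝ, E) 𝓘(ℝ, E) (extChartAt 𝓘(ℝ, E) q)
        ((extChartAt 𝓘(ℝ, E) q).symm z) v := ⟨_, rfl⟩
      have n1 := norm_mfderiv_chartShift hφ1 hs (h := h) (by rw [hez]; exact hshift h hh z hz) v hw
      have n2 := norm_mfderiv_chartShift hφ1 hs (h := -h)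
        (by rw [hez]; exact hshift (-h) hh' z hz) v hw
      have n3 := norm_chartSymmDeriv_mfderiv_chart q hs v
      rw [← hw, hez] at n3
      rw [hez] at n1 n2
      rw [n1, n2]
      have hwv : ‖w‖ ≤ A * ‖v‖ := by
        rw [← n3]
        exact (hball (hKsub z hz)).1.1 w
      set k : E := φ z • h with hk
      have hkh : ‖k‖ ≤ ‖h‖ := by
        rw [hk, norm_smul, Real.norm_of_nonneg φ.nonneg]
        exact mul_le_of_le_one_left (norm_nonneg _) φ.le_one
      have hkδ : ‖k‖ < δ := by linarith
      have hzδ := (hball (hKsub z hz)).2.1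
      obtain ⟨s1, s2, s3⟩ := hsecond z hzδ k hkδ
      obtain ⟨s4, -, -⟩ := hsecond z hzδ (-k) (by rwa [norm_neg])
      rw [← sub_eq_add_neg] at s4
      have ht : |fderiv ℝ φ z w| ≤ B * ‖w‖ :=
        ((fderiv ℝ φ z).le_opNorm w).trans (by gcongr; exact hB z)
      have hmain := add_le_of_second_difference (h := h) (w := w) hC hB0 s1 s4
        (s2.trans (by gcongr)) (s3.trans (by gcongr)) ht
      rw [chartMetric_self, chartMetric_self, chartMetric_self, n3] at hmain
      rw [smul_neg, smul_neg, ← hk, ← sub_eq_add_neg, ← sub_eq_add_neg]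
      set a := ‖chartSymmDeriv q (z + k) (w + (fderiv ℝ φ z w) • h)‖
      set b := ‖chartSymmDeriv q (z - k) (w - (fderiv ℝ φ z w) • h)‖
      have hsq : a ^ 2 + b ^ 2 ≤ (2 + C' * ‖h‖ ^ 2) * ‖v‖ ^ 2 := by
        have : C * (1 + 2 * B + 2 * B ^ 2) * ‖h‖ ^ 2 * ‖w‖ ^ 2 ≤
            C * (1 + 2 * B + 2 * B ^ 2) * ‖h‖ ^ 2 * (A * ‖v‖) ^ 2 := by gcongr
        rw [hC']
        linarith
      have hD : 0 ≤ C' * ‖h‖ ^ 2 := by positivity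
      refine abs_le_of_sq_le_sq' ?_ (by positivity) |>.2
      have hv2 : 0 ≤ ‖v‖ ^ 2 := by positivity
      have : (a + b) ^ 2 ≤ 2 * (a ^ 2 + b ^ 2) := add_sq_le
      nlinarith [mul_nonneg (mul_nonneg hD hD) hv2]
    · have hid : ∀ h : E, HasMFDerivAt 𝓘(ℝ, E) 𝓘(ℝ, E) (chartShift q φ h) x
          (ContinuousLinearMap.id ℝ (TangentSpace 𝓘(ℝ, E) x)) := fun h =>
        (hasMFDerivAt_id x).congr_of_eventuallyEq (chartShift_eventuallyEq_id hφK hK hKt h hx)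
      have hnorm : ∀ h : E, ‖mfderiv 𝓘(ℝ, E) 𝓘(ℝ, E) (chartShift q φ h) x v‖ = ‖v‖ := fun h =>
        norm_tangentSpace_congr (chartShift_of_notMem hφK h hx) (congr($((hid h).mfderiv) v))
      rw [hnorm, hnorm]
      have : 0 ≤ C' / 2 * ‖h‖ ^ 2 * ‖v‖ := by positivity
      linarith
  have hfinal := dist_add_dist_le_of_norm_mfderiv_add_le
    (contMDiff_chartShift hφ1 hφK hK hKt (hshift h hh))
    (contMDiff_chartShift hφ1 hφK hK hKt (hshift (-h) hh')) (by positivity) hstretch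
    m ((extChartAt 𝓘(ℝ, E) q).symm y)
  have hmK : m ∉ (extChartAt 𝓘(ℝ, E) q).symm '' K := by
    rintro ⟨z, hz, rfl⟩
    exact not_lt_of_ge hm (hball (hKsub z hz)).2.2
  have hyK : y ∈ K := ball_subset_closedBall (ball_subset_ball (by linarith) hy)
  have hφy : φ y = 1 := φ.one_of_mem_closedBall (ball_subset_closedBall hy)
  rwa [chartShift_of_notMem hφK h hmK, chartShift_of_notMem hφK (-h) hmK,
    chartShift_chart_symm _ _ (hKt hyK), chartShift_chart_symm _ _ (hKt hyK), hφy, one_smul,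
    one_smul, ← sub_eq_add_neg] at hfinal

end Semiconcavity

/-! ### The distance functions in a chart -/

section DistChart

-- the search for the metric structure on bilinear forms exceeds the default limit
set_option synthInstance.maxHeartbeats 200000 in
lemma ContinuousAt.eventually_abs_bilin_sub_le {X : Type*} [TopologicalSpace X]
    {g : X → E →L[ℝ] E →L[ℝ] ℝ} {z : X} (hg : ContinuousAt g z) {ε : ℝ} (hε : 0 < ε) :
    ∀ᶠ y in 𝓝 z, ∀ w, |g y w w - g z w w| ≤ ε * ‖w‖ ^ 2 := by
  filter_upwards [Metric.tendsto_nhds (α := E →L[ℝ] E →L[ℝ] ℝ).mp hg ε hε] with y hy w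
  have hy' : ‖g y - g z‖ < ε := (dist_eq_norm (g y) (g z)).symm.trans_lt hy
  have := (g y - g z).le_opNorm₂ w w
  rw [sub_apply, sub_apply, Real.norm_eq_abs] at this
  refine this.trans ?_
  rw [mul_assoc, ← sq]
  gcongr

lemma ContinuousAt.exists_eventually_bilin_le {X : Type*} [TopologicalSpace X]
    {g : X → E →L[ℝ] E →L[ℝ] ℝ} {z : X} (hg : ContinuousAt g z) :
    ∃ c : ℝ, 0 ≤ c ∧ ∀ᶠ y in 𝓝 z, ∀ w, g y w w ≤ c * ‖w‖ ^ 2 := by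
  refine ⟨‖g z‖ + 1, by positivity, ?_⟩
  filter_upwards [hg.eventually_abs_bilin_sub_le one_pos] with y hy w
  have h1 := (le_abs_self _).trans (hy w)
  have h2 := (le_abs_self _).trans ((g z).le_opNorm₂ w w)
  linarith

variable [FiniteDimensional ℝ E]
variable {M : Type*} [MetricSpace M] [ChartedSpace E M] [IsManifold 𝓘(ℝ, E) ∞ M]
  [RiemannianBundle (fun p : M => TangentSpace 𝓘(ℝ, E) p)]
  [IsContMDiffRiemannianBundle 𝓘(ℝ, E) ∞ E (fun p : M => TangentSpace 𝓘(ℝ, E) p)]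
  [IsRiemannianManifold 𝓘(ℝ, E) M]

omit [IsRiemannianManifold 𝓘(ℝ, E) M] in
lemma continuousAt_chartMetric (q : M) :
    ContinuousAt (chartMetric (E := E) q) (extChartAt 𝓘(ℝ, E) q q) :=
  ((contDiffOn_chartMetric (E := E) q).contDiffAt (extChartAt_target_mem_nhds q)).continuousAt

/-- The inverse of a chart is Lipschitz near its base point, for the Riemannian distance. -/
lemma exists_dist_chart_symm_le (q : M) :
    ∃ K : NNReal, ∃ s ∈ 𝓝 (extChartAt 𝓘(ℝ, E) q q),
      LipschitzOnWith K (extChartAt 𝓘(ℝ, E) q).symm s := by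
  set y₀ : E := extChartAt 𝓘(ℝ, E) q q
  obtain ⟨c, hc, hbdd⟩ := (continuousAt_chartMetric (E := E) q).exists_eventually_bilin_le
  obtain ⟨ρ, hρ, hball⟩ := Metric.mem_nhds_iff.mp (inter_mem hbdd (extChartAt_target_mem_nhds q))
  refine ⟨⟨√c, Real.sqrt_nonneg _⟩, ball y₀ ρ, ball_mem_nhds _ hρ, ?_⟩
  refine LipschitzOnWith.of_dist_le_mul fun u hu v hv => ?_
  have hseg := (convex_ball y₀ ρ).segment_subset hu hv
  refine dist_chart_symm_le q (fun y hy => (hball (hseg hy)).2) fun y hy => ?_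
  have h1 : ‖chartSymmDeriv q y (v - u)‖ ^ 2 ≤ c * ‖v - u‖ ^ 2 := by
    rw [← chartMetric_self]
    exact (hball (hseg hy)).1 _
  have h2 := Real.sqrt_le_sqrt h1
  rw [Real.sqrt_sq (norm_nonneg _), Real.sqrt_mul hc, Real.sqrt_sq (norm_nonneg _)] at h2
  rwa [dist_comm, dist_eq_norm]

omit [FiniteDimensional ℝ E] [IsManifold 𝓘(ℝ, E) ∞ M]
  [RiemannianBundle (fun p : M => TangentSpace 𝓘(ℝ, E) p)]
  [IsContMDiffRiemannianBundle 𝓘(ℝ, E) ∞ E (fun p : M => TangentSpace 𝓘(ℝ, E) p)]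
  [IsRiemannianManifold 𝓘(ℝ, E) M] in
lemma continuousAt_dist_chart_symm (p q : M) :
    ContinuousAt (fun y => dist p ((extChartAt 𝓘(ℝ, E) q).symm y)) (extChartAt 𝓘(ℝ, E) q q) := by
  have := continuousAt_extChartAt_symm (I := 𝓘(ℝ, E)) q
  fun_prop

/-- The square of the distance to a point has an upper support everywhere. -/
lemma exists_hasUpperSupport_dist_sq (p q : M) :
    ∃ L : E →L[ℝ] ℝ, HasUpperSupport (fun y => dist p ((extChartAt 𝓘(ℝ, E) q).symm y) ^ 2) L
      (extChartAt 𝓘(ℝ, E) q q) := by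
  obtain ⟨K, s, hs, hK⟩ := exists_dist_chart_symm_le (E := E) q
  by_cases hpq : p = q
  · -- the square of the distance to `q` itself is of second order at `q`
    subst hpq
    refine ⟨0, fun y => K ^ 2 * ‖y - extChartAt 𝓘(ℝ, E) p p‖ ^ 2, ?_, by simp, ?_⟩
    · rw [hasFDerivAt_iff_isLittleO_nhds_zero]
      have : (fun h : E => ‖h‖ ^ 2) =o[𝓝 0] fun h => h :=
        Asymptotics.isLittleO_norm_pow_id one_lt_two
      refine (this.const_mul_left ((K : ℝ) ^ 2)).congr_left fun h => ?_
      simp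
    · filter_upwards [hs] with y hy
      have := hK.dist_le_mul _ (mem_of_mem_nhds hs) y hy
      rw [extChartAt_to_inv, dist_comm (extChartAt 𝓘(ℝ, E) p p), dist_eq_norm] at this
      rw [← mul_pow]
      gcongr
  · obtain ⟨C, hC, δ, hδ, hsemi⟩ := exists_dist_add_dist_le (E := E) q (dist_pos.mpr hpq)
    have hLip : LipschitzOnWith K (fun y => dist p ((extChartAt 𝓘(ℝ, E) q).symm y)) s := by
      refine LipschitzOnWith.of_dist_le_mul fun u hu v hv => ?_
      rw [Real.dist_eq]
      refine le_trans ?_ (hK.dist_le_mul u hu v hv)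
      rw [dist_comm p, dist_comm p]
      exact abs_dist_sub_le _ _ _
    have hbdd : ∀ᶠ y in 𝓝 (extChartAt 𝓘(ℝ, E) q q),
        dist p ((extChartAt 𝓘(ℝ, E) q).symm y) < dist p q + 1 := by
      refine (continuousAt_dist_chart_symm p q).eventually_lt_const ?_
      beta_reduce
      rw [extChartAt_to_inv]
      linarith
    obtain ⟨ρ, hρ, hball⟩ := Metric.mem_nhds_iff.mp hbdd
    have hmid : MidpointSemiconcaveAt (fun y => dist p ((extChartAt 𝓘(ℝ, E) q).symm y))
        (extChartAt 𝓘(ℝ, E) q q) := by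
      refine ⟨C * (dist p q + 1), min δ ρ, lt_min hδ hρ, fun y hy h hh => ?_⟩
      refine (hsemi p le_rfl y (ball_subset_ball (min_le_left _ _) hy) h
        (hh.trans_le (min_le_left _ _))).trans ?_
      have h1 : dist p ((extChartAt 𝓘(ℝ, E) q).symm y) ≤ dist p q + 1 :=
        le_of_lt (hball (ball_subset_ball (min_le_right _ _) hy))
      have h2 : C * ‖h‖ ^ 2 * dist p ((extChartAt 𝓘(ℝ, E) q).symm y) ≤
          C * ‖h‖ ^ 2 * (dist p q + 1) := by gcongr
      linarith
    obtain ⟨L, hL⟩ := hmid.exists_hasUpperSupport hs hLip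
    exact ⟨_, hL.sq fun y => dist_nonneg⟩

/-- The distance is jointly semiconcave near a pair of distinct points. By the triangle inequality
at an almost intermediate point this follows from semiconcavity in each variable. -/
lemma midpointSemiconcaveAt_dist {p q : M} (hpq : p ≠ q) :
    MidpointSemiconcaveAt (fun z : E × E => dist ((extChartAt 𝓘(ℝ, E) p).symm z.1)
      ((extChartAt 𝓘(ℝ, E) q).symm z.2)) (extChartAt 𝓘(ℝ, E) p p, extChartAt 𝓘(ℝ, E) q q) := by
  have hd : 0 < dist p q := dist_pos.mpr hpq
  set r : ℝ := dist p q / 8 with hr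
  have hr0 : 0 < r := by positivity
  obtain ⟨C₁, hC₁, δ₁, hδ₁, h₁⟩ := exists_dist_add_dist_le (E := E) p hr0
  obtain ⟨C₂, hC₂, δ₂, hδ₂, h₂⟩ := exists_dist_add_dist_le (E := E) q hr0
  have hnear : ∀ p : M, ∃ ρ > 0, ∀ y ∈ ball (extChartAt 𝓘(ℝ, E) p p) ρ,
      dist ((extChartAt 𝓘(ℝ, E) p).symm y) p < r := by
    intro p
    have hcont := continuousAt_extChartAt_symm (I := 𝓘(ℝ, E)) p
    rw [ContinuousAt, extChartAt_to_inv] at hcont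
    exact Metric.mem_nhds_iff.mp (hcont (ball_mem_nhds p hr0))
  obtain ⟨ρ₁, hρ₁, hn₁⟩ := hnear p
  obtain ⟨ρ₂, hρ₂, hn₂⟩ := hnear q
  refine ⟨(C₁ + C₂) * (dist p q + 2 * r), min (min δ₁ δ₂) (min ρ₁ ρ₂), by positivity, ?_⟩
  rintro ⟨y₁, y₂⟩ hy ⟨k₁, k₂⟩ hk
  rw [← ball_prod_same, mem_prod] at hy
  simp only [mem_ball, lt_min_iff] at hy
  obtain ⟨⟨⟨hy1, -⟩, hy1', -⟩, ⟨-, hy2⟩, -, hy2'⟩ := hy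
  rw [lt_min_iff, lt_min_iff] at hk
  have hk1 : ‖k₁‖ ≤ ‖(k₁, k₂)‖ := norm_fst_le (k₁, k₂)
  have hk2 : ‖k₂‖ ≤ ‖(k₁, k₂)‖ := norm_snd_le (k₁, k₂)
  set N : ℝ := ‖(k₁, k₂)‖
  simp only [Prod.mk_add_mk, Prod.mk_sub_mk]
  have hP := hn₁ y₁ hy1'
  have hQ := hn₂ y₂ hy2'
  set P := (extChartAt 𝓘(ℝ, E) p).symm y₁
  set Q := (extChartAt 𝓘(ℝ, E) q).symm y₂
  have hPQ1 : dist p q ≤ dist P Q + 2 * r := by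
    have := dist_triangle4 p P Q q
    rw [dist_comm p P] at this
    linarith
  have hPQ2 : dist P Q ≤ dist p q + 2 * r := by
    have := dist_triangle4 P p q Q
    rw [dist_comm q Q] at this
    linarith
  have hPQ0 : 0 ≤ dist P Q := dist_nonneg
  have key : ∀ ε > 0, dist ((extChartAt 𝓘(ℝ, E) p).symm (y₁ + k₁))
      ((extChartAt 𝓘(ℝ, E) q).symm (y₂ + k₂)) + dist ((extChartAt 𝓘(ℝ, E) p).symm (y₁ - k₁))
      ((extChartAt 𝓘(ℝ, E) q).symm (y₂ - k₂)) ≤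
      (2 + C₁ * N ^ 2) * (dist P Q / 2) + (2 + C₂ * N ^ 2) * (dist P Q / 2 + ε) := by
    intro ε hε
    obtain ⟨m, hm1, hm2⟩ := exists_almost_between E P Q (s := dist P Q / 2) (by positivity)
      (by linarith) hε
    have hmp : r ≤ dist m p := by
      have := dist_triangle P p m
      rw [dist_comm p m] at this
      linarith
    have hmq : r ≤ dist m q := by
      have h1 := dist_triangle P m Q
      have h2 := dist_triangle m q Q
      rw [dist_comm q Q] at h2
      linarith
    have e1 := h₁ m hmp y₁ hy1 k₁ (by linarith)
    have e2 := h₂ m hmq y₂ hy2 k₂ (by linarith)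
    have t1 := dist_triangle ((extChartAt 𝓘(ℝ, E) p).symm (y₁ + k₁)) m
      ((extChartAt 𝓘(ℝ, E) q).symm (y₂ + k₂))
    have t2 := dist_triangle ((extChartAt 𝓘(ℝ, E) p).symm (y₁ - k₁)) m
      ((extChartAt 𝓘(ℝ, E) q).symm (y₂ - k₂))
    rw [dist_comm _ m] at t1 t2
    have e1' : (2 + C₁ * ‖k₁‖ ^ 2) * dist m P ≤ (2 + C₁ * N ^ 2) * (dist P Q / 2) := by
      rw [dist_comm m P, hm1]
      gcongr
    have e2' : (2 + C₂ * ‖k₂‖ ^ 2) * dist m Q ≤ (2 + C₂ * N ^ 2) * (dist P Q / 2 + ε) := by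
      gcongr
      linarith
    linarith
  have hlim : Tendsto (fun ε : ℝ => (2 + C₁ * N ^ 2) * (dist P Q / 2) +
      (2 + C₂ * N ^ 2) * (dist P Q / 2 + ε)) (𝓝[>] 0)
      (𝓝 ((2 + C₁ * N ^ 2) * (dist P Q / 2) + (2 + C₂ * N ^ 2) * (dist P Q / 2 + 0))) :=
    (Continuous.tendsto (by fun_prop) _).mono_left nhdsWithin_le_nhds
  have := ge_of_tendsto hlim (by filter_upwards [self_mem_nhdsWithin] with ε hε using key ε hε)
  refine this.trans ?_
  have h5 : (C₁ + C₂) * N ^ 2 * dist P Q ≤ (C₁ + C₂) * N ^ 2 * (dist p q + 2 * r) := by gcongr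
  have h6 : 0 ≤ (C₁ + C₂) * N ^ 2 * dist P Q := by positivity
  linarith

/-- The derivative of a distance function has Riemannian norm at most one. -/
lemma abs_apply_le_of_hasFDerivAt_dist {p q : M} {L : E →L[ℝ] ℝ}
    (hL : HasFDerivAt (fun y => dist p ((extChartAt 𝓘(ℝ, E) q).symm y)) L
      (extChartAt 𝓘(ℝ, E) q q)) (w : E) :
    |L w| ≤ ‖chartSymmDeriv q (extChartAt 𝓘(ℝ, E) q q) w‖ := by
  set y₀ : E := extChartAt 𝓘(ℝ, E) q q
  refine le_of_forall_gt_imp_ge_of_dense fun K hK => ?_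
  have hK0 : 0 ≤ K := (norm_nonneg _).trans hK.le
  have hcont : ContinuousAt (fun y => chartMetric q y w w) y₀ :=
    ((continuousAt_chartMetric (E := E) q).clm_apply continuousAt_const).clm_apply
      continuousAt_const
  have hlt : ∀ᶠ y in 𝓝 y₀, chartMetric q y w w < K ^ 2 := by
    refine hcont.eventually_lt_const ?_
    beta_reduce
    rw [chartMetric_self]
    gcongr
  obtain ⟨ρ, hρ, hball⟩ := Metric.mem_nhds_iff.mp (inter_mem hlt (extChartAt_target_mem_nhds q))
  have hslope := (hL.hasLineDerivAt w).tendsto_slope_zero_right.abs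
  refine le_of_tendsto hslope ?_
  have hsmall : ∀ᶠ t : ℝ in 𝓝[>] 0, y₀ + t • w ∈ ball y₀ ρ := by
    have : Tendsto (fun t : ℝ => y₀ + t • w) (𝓝 0) (𝓝 y₀) :=
      Continuous.tendsto' (by fun_prop) _ _ (by simp)
    exact (this.mono_left nhdsWithin_le_nhds).eventually (ball_mem_nhds y₀ hρ)
  filter_upwards [hsmall, self_mem_nhdsWithin] with t ht ht0
  replace ht0 : 0 < t := ht0
  have hseg := (convex_ball y₀ ρ).segment_subset (mem_ball_self hρ) ht
  have hdist : dist ((extChartAt 𝓘(ℝ, E) q).symm y₀)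
      ((extChartAt 𝓘(ℝ, E) q).symm (y₀ + t • w)) ≤ t * K := by
    refine dist_chart_symm_le q (fun y hy => (hball (hseg hy)).2) fun y hy => ?_
    rw [add_sub_cancel_left, map_smul, norm_smul, Real.norm_of_nonneg ht0.le]
    gcongr
    have := (hball (hseg hy)).1
    rw [mem_ofPred_eq, chartMetric_self] at this
    exact (lt_of_pow_lt_pow_left₀ 2 hK0 this).le
  rw [smul_eq_mul, abs_mul, abs_inv, abs_of_pos ht0, inv_mul_le_iff₀ ht0]
  refine le_trans ?_ hdist
  rw [dist_comm p, dist_comm p]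
  refine (abs_dist_sub_le _ _ _).trans_eq (dist_comm _ _)

/-- The derivative of the distance function of a point `p ≠ q`, if it exists at `q`, has
Riemannian norm at least one: almost minimizing paths from `q` to `p` are directions along which
the distance to `p` decreases at almost unit speed. -/
lemma one_le_of_hasFDerivAt_dist {p q : M} (hpq : p ≠ q) {L : E →L[ℝ] ℝ}
    (hL : HasFDerivAt (fun y => dist p ((extChartAt 𝓘(ℝ, E) q).symm y)) L
      (extChartAt 𝓘(ℝ, E) q q)) {c : ℝ} (hc : 0 ≤ c)
    (hLc : ∀ w, |L w| ≤ c * ‖chartSymmDeriv q (extChartAt 𝓘(ℝ, E) q q) w‖) : 1 ≤ c := by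
  by_contra! hc1
  set y₀ : E := extChartAt 𝓘(ℝ, E) q q with hy₀
  obtain ⟨A, hA, hAnorm⟩ := eventually_norm_le_chartSymmDeriv (E := E) q
  set c' : ℝ := (c + 1) / 2 with hc'
  have hcc' : c < c' := by linarith
  have hc'1 : c' < 1 := by linarith
  -- by continuity of the metric, the bound by a constant smaller than one holds near `q`
  have hbound : ∀ᶠ y in 𝓝 y₀, ∀ w, ‖L w‖ ≤ c' * ‖chartSymmDeriv q y w‖ := by
    have hη : 0 < (c' ^ 2 - c ^ 2) / A ^ 2 := by
      have : c ^ 2 < c' ^ 2 := by gcongr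
      have : 0 < c' ^ 2 - c ^ 2 := by linarith
      positivity
    filter_upwards [(continuousAt_chartMetric (E := E) q).eventually_abs_bilin_sub_le hη,
      hAnorm] with y hy hyA w
    have h1 := hy w
    rw [chartMetric_self, chartMetric_self] at h1
    have h2 : (c' ^ 2 - c ^ 2) / A ^ 2 * ‖w‖ ^ 2 ≤
        (c' ^ 2 - c ^ 2) * ‖chartSymmDeriv q y w‖ ^ 2 := by
      calc (c' ^ 2 - c ^ 2) / A ^ 2 * ‖w‖ ^ 2
          ≤ (c' ^ 2 - c ^ 2) / A ^ 2 * (A * ‖chartSymmDeriv q y w‖) ^ 2 := by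
            gcongr
            exact hyA w
        _ = _ := by field_simp
    have h3 : |L w| ^ 2 ≤ c ^ 2 * ‖chartSymmDeriv q y₀ w‖ ^ 2 := by
      rw [← mul_pow]
      gcongr
      exact hLc w
    have h4 := (abs_le.mp h1).1
    have h5 : c ^ 2 ≤ 1 := by nlinarith
    have h6 : 0 ≤ (c' ^ 2 - c ^ 2) / A ^ 2 * ‖w‖ ^ 2 := by positivity
    rw [Real.norm_eq_abs]
    refine abs_le_of_sq_le_sq' ?_ (by positivity) |>.2
    rw [mul_pow]
    nlinarith
  have hLlip := eventually_norm_chart_sub_le q L (by linarith : 0 ≤ c') hbound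
  have hAlip := eventually_norm_chart_sub_le q (ContinuousLinearMap.id ℝ E) hA.le hAnorm
  set η : ℝ := (1 - c') / (2 * A) with hη
  have hη0 : 0 < η := div_pos (by linarith) (by positivity)
  have hηA : η * A = (1 - c') / 2 := by rw [hη]; field_simp
  rw [hasFDerivAt_iff_isLittleO, Asymptotics.isLittleO_iff] at hL
  have hder := (continuousAt_extChartAt (I := 𝓘(ℝ, E)) q).eventually (hL hη0)
  obtain ⟨ρ, hρ, hball⟩ := Metric.mem_nhds_iff.mp (inter_mem (inter_mem hLlip hAlip)
    (inter_mem hder (extChartAt_source_mem_nhds (I := 𝓘(ℝ, E)) q)))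
  have hd : 0 < dist q p := dist_pos.mpr hpq.symm
  set s : ℝ := min (ρ / 2) (dist q p) with hs
  have hs0 : 0 < s := by positivity
  have hsρ : s < ρ := (min_le_left _ _).trans_lt (by linarith)
  obtain ⟨m, hm1, hm2⟩ := exists_almost_between E q p hs0.le (min_le_right _ _)
    (ε := (1 - c') / 4 * s) (mul_pos (by linarith) hs0)
  obtain ⟨⟨b1, b2⟩, b3, b4⟩ := hball (show m ∈ ball q ρ by rwa [mem_ball, dist_comm, hm1])
  simp only [mem_ofPred_eq, ContinuousLinearMap.id_apply, hm1] at b1 b2 b3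
  rw [(extChartAt 𝓘(ℝ, E) q).left_inv b4, extChartAt_to_inv, map_sub] at b3
  have b5 : η * ‖extChartAt 𝓘(ℝ, E) q m - extChartAt 𝓘(ℝ, E) q q‖ ≤ (1 - c') / 2 * s := by
    rw [← hηA, mul_assoc]
    gcongr
  rw [Real.norm_eq_abs, abs_le] at b1 b3
  rw [dist_comm m p, dist_comm q p] at hm2
  have b6 : 0 < (1 - c') * s := mul_pos (by linarith) hs0
  linarith [b1.1, b3.1]

end DistChart

/-! ### Gradients in charts -/

section Gradient

variable {M : Type*} [TopologicalSpace M] [ChartedSpace E M]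
  [RiemannianBundle (fun p : M => TangentSpace 𝓘(ℝ, E) p)]

lemma HasRiemannianGradientAt.exists_hasFDerivAt {f : M → ℝ} {p : M} {v : TangentSpace 𝓘(ℝ, E) p}
    (h : HasRiemannianGradientAt f p v) :
    ∃ L : E →L[ℝ] ℝ, HasFDerivAt (fun y => f ((extChartAt 𝓘(ℝ, E) p).symm y)) L
      (extChartAt 𝓘(ℝ, E) p p) ∧ ∀ w : TangentSpace 𝓘(ℝ, E) p, inner ℝ v w = L w := by
  refine ⟨mfderiv 𝓘(ℝ, E) 𝓘(ℝ, ℝ) f p, ?_, h.2⟩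
  have := h.1.hasMFDerivAt.2
  rw [modelWithCornersSelf_coe, range_id] at this
  exact this.hasFDerivAt_of_univ

omit [RiemannianBundle (fun p : M => TangentSpace 𝓘(ℝ, E) p)] in
lemma hasMFDerivAt_of_hasFDerivAt_chart {f : M → ℝ} {p : M} (hf : ContinuousAt f p)
    {L : E →L[ℝ] ℝ} (hL : HasFDerivAt (fun y => f ((extChartAt 𝓘(ℝ, E) p).symm y)) L
      (extChartAt 𝓘(ℝ, E) p p)) : HasMFDerivAt 𝓘(ℝ, E) 𝓘(ℝ, ℝ) f p L := by
  refine ⟨hf, ?_⟩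
  rw [modelWithCornersSelf_coe, range_id]
  exact hL.hasFDerivWithinAt

/-- By the Riesz representation theorem, a function which is differentiable in a chart has a
gradient. -/
lemma exists_hasRiemannianGradientAt [FiniteDimensional ℝ E] {f : M → ℝ} {p : M}
    (hf : ContinuousAt f p) {L : E →L[ℝ] ℝ}
    (hL : HasFDerivAt (fun y => f ((extChartAt 𝓘(ℝ, E) p).symm y)) L (extChartAt 𝓘(ℝ, E) p p)) :
    ∃ v : TangentSpace 𝓘(ℝ, E) p, HasRiemannianGradientAt f p v ∧
      ∀ w : TangentSpace 𝓘(ℝ, E) p, inner ℝ v w = L w := by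
  have : FiniteDimensional ℝ (TangentSpace 𝓘(ℝ, E) p) := inferInstanceAs (FiniteDimensional ℝ E)
  have : CompleteSpace (TangentSpace 𝓘(ℝ, E) p) := FiniteDimensional.complete ℝ _
  have hm := hasMFDerivAt_of_hasFDerivAt_chart hf hL
  let L' : TangentSpace 𝓘(ℝ, E) p →L[ℝ] ℝ := L
  refine ⟨(InnerProductSpace.toDual ℝ (TangentSpace 𝓘(ℝ, E) p)).symm L',
    ⟨hm.mdifferentiableAt, fun w => ?_⟩, fun w => ?_⟩
  · rw [hm.mfderiv, InnerProductSpace.toDual_symm_apply]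
    rfl
  · rw [InnerProductSpace.toDual_symm_apply]
    rfl

variable {k : ℕ}

/-- The extended charts of the power of `M` are the products of those of `M`, so a vanishing gradient
on it is a vanishing derivative in the product of the charts. -/
lemma hasProductGradientAt_zero_iff {f : (Fin k → M) → ℝ} {x : Fin k → M}
    (hf : ContinuousAt f x) :
    HasProductGradientAt (E := E) f x 0 ↔
      HasFDerivAt (fun y : Fin k → E => f fun i => (extChartAt 𝓘(ℝ, E) (x i)).symm (y i))
        (0 : (Fin k → E) →L[ℝ] ℝ) (fun i => extChartAt 𝓘(ℝ, E) (x i) (x i)) := by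
  have hrange : range (ModelWithCorners.pi fun _ : Fin k => 𝓘(ℝ, E)) = univ := by
    refine range_eq_univ.mpr fun y => ⟨y, rfl⟩
  have hzero : ∀ w : (i : Fin k) → TangentSpace 𝓘(ℝ, E) (x i),
      ∑ i, inner ℝ ((0 : (i : Fin k) → TangentSpace 𝓘(ℝ, E) (x i)) i) (w i) = 0 :=
    fun w => Finset.sum_eq_zero fun i _ => inner_zero_left (w i)
  constructor
  · rintro ⟨hd, hgrad⟩
    have h := hd.hasMFDerivAt.2
    rw [hrange] at h
    have h0 : mfderiv (ModelWithCorners.pi fun _ : Fin k => 𝓘(ℝ, E)) 𝓘(ℝ, ℝ) f x =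
        (0 : (Fin k → E) →L[ℝ] ℝ) := by
      refine ContinuousLinearMap.ext fun w => ?_
      exact (hgrad w).symm.trans (hzero w)
    rw [h0] at h
    exact h.hasFDerivAt_of_univ
  · intro h
    have hm : HasMFDerivAt (ModelWithCorners.pi fun _ : Fin k => 𝓘(ℝ, E)) 𝓘(ℝ, ℝ) f x
        (0 : (Fin k → E) →L[ℝ] ℝ) := by
      refine ⟨hf, ?_⟩
      rw [hrange]
      exact h.hasFDerivWithinAt
    refine ⟨hm.mdifferentiableAt, fun w => ?_⟩
    rw [hm.mfderiv]
    exact hzero w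

end Gradient

/-! ### The uniform energy -/

section Energy

variable {k : ℕ} [NeZero k]

lemma continuous_uniformEnergy {M : Type*} [MetricSpace M] :
    Continuous (uniformEnergy : (Fin k → M) → ℝ) := by
  unfold uniformEnergy
  fun_prop

lemma uniformEnergy_eq_mul_sum {M : Type*} [MetricSpace M] (x : Fin k → M) :
    uniformEnergy x = k * ∑ i, dist (x i) (x (i + 1)) ^ 2 := by
  unfold uniformEnergy
  rw [Finset.mul_sum]
  refine Finset.sum_congr rfl fun i _ => ?_
  rw [one_div, div_inv_eq_mul, mul_comm]

/-- As a function of the point with index `i` alone, the energy is, up to constants, the sum of the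
squared distances to the two neighbours. -/
lemma exists_uniformEnergy_update {M : Type*} [MetricSpace M] (x : Fin k → M) {i : Fin k}
    (hi : i - 1 ≠ i) : ∃ c : ℝ, ∀ m : M, uniformEnergy (Function.update x i m) =
      k * (dist (x (i - 1)) m ^ 2 + dist (x (i + 1)) m ^ 2) + c := by
  have hi' : i + 1 ≠ i := fun h => hi (by rw [sub_eq_iff_eq_add]; exact h.symm)
  refine ⟨k * ∑ j ∈ ({i - 1, i} : Finset (Fin k))ᶜ, dist (x j) (x (j + 1)) ^ 2, fun m => ?_⟩
  rw [uniformEnergy_eq_mul_sum, ← Finset.sum_add_sum_compl ({i - 1, i} : Finset (Fin k)),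
    Finset.sum_pair hi, mul_add]
  congr 2
  · rw [sub_add_cancel, Function.update_self, Function.update_of_ne hi, Function.update_of_ne hi',
      dist_comm m]
  · refine Finset.sum_congr rfl fun j hj => ?_
    simp only [Finset.mem_compl, Finset.mem_insert, Finset.mem_singleton, not_or] at hj
    rw [Function.update_of_ne hj.2, Function.update_of_ne]
    exact fun h => hj.1 (eq_sub_of_add_eq h)

/-- If consecutive distances agree along a cyclic sequence, then they are all equal; as the energy
does not vanish, they are not zero. -/
lemma dist_ne_zero_of_uniformEnergy_ne_zero {M : Type*} [MetricSpace M] {x : Fin k → M}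
    (hx : uniformEnergy x ≠ 0)
    (h : ∀ i, dist (x (i - 1)) (x i) = dist (x i) (x (i + 1))) :
    ∃ d : ℝ, d ≠ 0 ∧ ∀ i, dist (x i) (x (i + 1)) = d := by
  have hstep : ∀ i : Fin k, dist (x (i + 1)) (x (i + 1 + 1)) = dist (x i) (x (i + 1)) := by
    intro i
    have := h (i + 1)
    rw [add_sub_cancel_right] at this
    exact this.symm
  have hconst : ∀ n : ℕ, dist (x (Fin.ofNat k n)) (x (Fin.ofNat k n + 1)) =
      dist (x 0) (x (0 + 1)) := by
    intro n
    induction n with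
    | zero => rfl
    | succ n ih =>
      have : Fin.ofNat k (n + 1) = Fin.ofNat k n + 1 := by
        ext
        simp [Fin.val_add]
      rw [this, hstep, ih]
  have hall : ∀ i : Fin k, dist (x i) (x (i + 1)) = dist (x 0) (x (0 + 1)) := by
    intro i
    simpa using hconst i
  refine ⟨_, fun h0 => hx ?_, hall⟩
  rw [uniformEnergy_eq_mul_sum,
    Finset.sum_eq_zero fun i _ => by rw [hall, h0, zero_pow two_ne_zero], mul_zero]

variable [FiniteDimensional ℝ E]
variable {M : Type*} [MetricSpace M] [ChartedSpace E M] [IsManifold 𝓘(ℝ, E) ∞ M]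
  [RiemannianBundle (fun p : M => TangentSpace 𝓘(ℝ, E) p)]
  [IsContMDiffRiemannianBundle 𝓘(ℝ, E) ∞ E (fun p : M => TangentSpace 𝓘(ℝ, E) p)]
  [IsRiemannianManifold 𝓘(ℝ, E) M]

omit [FiniteDimensional ℝ E] [IsManifold 𝓘(ℝ, E) ∞ M]
  [RiemannianBundle (fun p : M => TangentSpace 𝓘(ℝ, E) p)]
  [IsContMDiffRiemannianBundle 𝓘(ℝ, E) ∞ E (fun p : M => TangentSpace 𝓘(ℝ, E) p)]
  [IsRiemannianManifold 𝓘(ℝ, E) M] in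
lemma hasFDerivAt_dist_of_hasFDerivAt_sq {p q : M} (hpq : p ≠ q) {L : E →L[ℝ] ℝ}
    (hL : HasFDerivAt (fun y => dist p ((extChartAt 𝓘(ℝ, E) q).symm y) ^ 2) L
      (extChartAt 𝓘(ℝ, E) q q)) :
    HasFDerivAt (fun y => dist p ((extChartAt 𝓘(ℝ, E) q).symm y))
      ((2 * dist p q)⁻¹ • L) (extChartAt 𝓘(ℝ, E) q q) := by
  have hne : dist p ((extChartAt 𝓘(ℝ, E) q).symm (extChartAt 𝓘(ℝ, E) q q)) ^ 2 ≠ 0 := by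
    rw [extChartAt_to_inv]
    exact pow_ne_zero 2 (dist_ne_zero.mpr hpq)
  have := hL.sqrt hne
  simp only [Real.sqrt_sq dist_nonneg, extChartAt_to_inv, one_div] at this
  exact this

/-- If the squared distance functions of `p` and `p'` have opposite derivatives at `q`, then
`q` is not farther from `p'` than from `p`, since the derivative of the squared distance to a point
at distance `d` has norm `2 * d`. -/
lemma dist_le_of_hasFDerivAt_neg {p p' q : M} {L : E →L[ℝ] ℝ}
    (hL : HasFDerivAt (fun y => dist p ((extChartAt 𝓘(ℝ, E) q).symm y) ^ 2) L
      (extChartAt 𝓘(ℝ, E) q q))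
    (hL' : HasFDerivAt (fun y => dist p' ((extChartAt 𝓘(ℝ, E) q).symm y) ^ 2) (-L)
      (extChartAt 𝓘(ℝ, E) q q)) : dist p' q ≤ dist p q := by
  by_cases hp' : p' = q
  · simp [hp']
  have hd' : 0 < dist p' q := dist_pos.mpr hp'
  have hbound : ∀ w, |L w| ≤ 2 * dist p q * ‖chartSymmDeriv q (extChartAt 𝓘(ℝ, E) q q) w‖ := by
    intro w
    by_cases hp : p = q
    · have hmin : IsLocalMin (fun y => dist p ((extChartAt 𝓘(ℝ, E) q).symm y) ^ 2)
          (extChartAt 𝓘(ℝ, E) q q) := by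
        refine Eventually.of_forall fun y => ?_
        simp only [extChartAt_to_inv, hp, dist_self, zero_pow two_ne_zero]
        positivity
      simp [hmin.hasFDerivAt_eq_zero hL, hp]
    · have hd : 0 < dist p q := dist_pos.mpr hp
      have := abs_apply_le_of_hasFDerivAt_dist (hasFDerivAt_dist_of_hasFDerivAt_sq hp hL) w
      rw [smul_apply, smul_eq_mul, abs_mul, abs_of_pos (by positivity),
        inv_mul_le_iff₀ (by positivity)] at this
      exact this
  have hone := one_le_of_hasFDerivAt_dist hp' (hasFDerivAt_dist_of_hasFDerivAt_sq hp' hL')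
    (c := (2 * dist p' q)⁻¹ * (2 * dist p q)) (by positivity) fun w => by
      rw [smul_apply, smul_eq_mul, abs_mul, abs_of_pos (by positivity), mul_assoc,
        neg_apply, abs_neg]
      gcongr
      exact hbound w
  rw [inv_mul_eq_div, one_le_div (by positivity)] at hone
  linarith

/-- If the sum of two squared distance functions is critical at `q`, then `q` is equidistant from
the two points and, away from them, both distance functions are differentiable at `q` with
opposite derivatives. -/
lemma dist_eq_and_hasFDerivAt_of_critical {p p' q : M}
    (h : HasFDerivAt (fun y => dist p ((extChartAt 𝓘(ℝ, E) q).symm y) ^ 2 +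
      dist p' ((extChartAt 𝓘(ℝ, E) q).symm y) ^ 2) (0 : E →L[ℝ] ℝ) (extChartAt 𝓘(ℝ, E) q q)) :
    dist p q = dist p' q ∧ (dist p q ≠ 0 → ∃ L : E →L[ℝ] ℝ,
      HasFDerivAt (fun y => dist p ((extChartAt 𝓘(ℝ, E) q).symm y)) L (extChartAt 𝓘(ℝ, E) q q) ∧
      HasFDerivAt (fun y => dist p' ((extChartAt 𝓘(ℝ, E) q).symm y)) (-L)
        (extChartAt 𝓘(ℝ, E) q q)) := by
  obtain ⟨L, hL⟩ := exists_hasUpperSupport_dist_sq (E := E) p q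
  obtain ⟨L', hL'⟩ := exists_hasUpperSupport_dist_sq (E := E) p' q
  obtain ⟨h1, h2, h3⟩ := hL.hasFDerivAt_of_add hL' h
  obtain rfl : L' = -L := eq_neg_of_add_eq_zero_right h3
  have heq : dist p q = dist p' q :=
    le_antisymm (dist_le_of_hasFDerivAt_neg h2 (by rwa [neg_neg]))
      (dist_le_of_hasFDerivAt_neg h1 h2)
  refine ⟨heq, fun hne => ⟨(2 * dist p q)⁻¹ • L, ?_, ?_⟩⟩
  · exact hasFDerivAt_dist_of_hasFDerivAt_sq (dist_ne_zero.mp hne) h1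
  · have := hasFDerivAt_dist_of_hasFDerivAt_sq (dist_ne_zero.mp (heq ▸ hne)) h2
    rwa [smul_neg, ← heq] at this

end Energy

end

theorem mainTheorem5
    {E : Type*} [NormedAddCommGroup E] [NormedSpace ℝ E] [FiniteDimensional ℝ E]
    {M : Type*} [MetricSpace M] [ChartedSpace E M] [IsManifold 𝓘(ℝ, E) ∞ M]
    [RiemannianBundle (fun p : M => TangentSpace 𝓘(ℝ, E) p)]
    [IsContMDiffRiemannianBundle 𝓘(ℝ, E) ∞ E (fun p : M => TangentSpace 𝓘(ℝ, E) p)]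
    [IsRiemannianManifold 𝓘(ℝ, E) M] [CompleteSpace M]
    {k : ℕ} [NeZero k] (x : Fin k → M) (hx : uniformEnergy x ≠ 0) :
    IsCriticalPointOfUniformEnergy E x ↔
      ∀ i : Fin k,
        dist (x (i - 1)) (x i) = dist (x i) (x (i + 1)) ∧
        ∃ u v : TangentSpace 𝓘(ℝ, E) (x i),
          HasRiemannianGradientAt (fun p => dist (x (i - 1)) p) (x i) u ∧
          HasRiemannianGradientAt (fun p => dist (x (i + 1)) p) (x i) v ∧
          u = -v := by
  unfold IsCriticalPointOfUniformEnergy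
  rw [hasProductGradientAt_zero_iff continuous_uniformEnergy.continuousAt]
  have hk0 : (k : ℝ) ≠ 0 := Nat.cast_ne_zero.mpr (NeZero.ne k)
  constructor
  · intro hcrit
    -- a one-point sequence has no energy, so neighbouring indices differ
    have hi : ∀ i : Fin k, i - 1 ≠ i := by
      intro i h
      refine hx ?_
      have h1 : (1 : Fin k) = 0 := by simpa using h
      rw [uniformEnergy_eq_mul_sum]
      simp [h1]
    -- restrict the energy to the variable with index `i`
    have hpartial : ∀ i, HasFDerivAt
        (fun y => dist (x (i - 1)) ((extChartAt 𝓘(ℝ, E) (x i)).symm y) ^ 2 +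
          dist (x (i + 1)) ((extChartAt 𝓘(ℝ, E) (x i)).symm y) ^ 2) (0 : E →L[ℝ] ℝ)
        (extChartAt 𝓘(ℝ, E) (x i) (x i)) := by
      intro i
      obtain ⟨c, hc⟩ := exists_uniformEnergy_update x (hi i)
      have hupd := hasFDerivAt_update (𝕜 := ℝ)
        (fun i => extChartAt 𝓘(ℝ, E) (x i) (x i)) (i := i) (extChartAt 𝓘(ℝ, E) (x i) (x i))
      have hcomp := HasFDerivAt.comp (extChartAt 𝓘(ℝ, E) (x i) (x i))
        (by rw [Function.update_eq_self]; exact hcrit) hupd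
      have hcomp2 : HasFDerivAt (fun y => k *
          (dist (x (i - 1)) ((extChartAt 𝓘(ℝ, E) (x i)).symm y) ^ 2 +
          dist (x (i + 1)) ((extChartAt 𝓘(ℝ, E) (x i)).symm y) ^ 2) + c) (0 : E →L[ℝ] ℝ)
          (extChartAt 𝓘(ℝ, E) (x i) (x i)) := by
        rw [ContinuousLinearMap.zero_comp] at hcomp
        refine hcomp.congr_of_eventuallyEq (Filter.Eventually.of_forall fun y => ?_)
        simp only [Function.comp_apply]
        rw [← hc]
        congr 1
        funext j
        by_cases hj : j = i
        · subst hj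
          simp
        · simp [Function.update_of_ne hj]
      have := (hcomp2.sub_const c).const_mul (k : ℝ)⁻¹
      simpa [hk0] using this
    have hlocal := fun i => dist_eq_and_hasFDerivAt_of_critical (hpartial i)
    have hdist : ∀ i, dist (x (i - 1)) (x i) = dist (x i) (x (i + 1)) := fun i => by
      rw [(hlocal i).1, dist_comm]
    obtain ⟨d, hd, hdall⟩ := dist_ne_zero_of_uniformEnergy_ne_zero hx hdist
    intro i
    refine ⟨hdist i, ?_⟩
    obtain ⟨L, hL, hL'⟩ := (hlocal i).2 (by rw [hdist, hdall]; exact hd)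
    obtain ⟨u, hu, huL⟩ := exists_hasRiemannianGradientAt
      (f := fun p => dist (x (i - 1)) p) (by fun_prop) hL
    obtain ⟨v, hv, hvL⟩ := exists_hasRiemannianGradientAt
      (f := fun p => dist (x (i + 1)) p) (by fun_prop) hL'
    refine ⟨u, v, hu, hv, ext_inner_right ℝ fun w => ?_⟩
    rw [inner_neg_left, huL, hvL]
    exact (neg_neg (L w)).symm
  · intro h
    obtain ⟨d, hd, hdall⟩ := dist_ne_zero_of_uniformEnergy_ne_zero hx fun i => (h i).1
    -- the derivative of the distance to the next point; the one for the previous point is opposite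
    have hV : ∀ i, ∃ V : E →L[ℝ] ℝ,
        HasFDerivAt (fun y => dist (x (i - 1)) ((extChartAt 𝓘(ℝ, E) (x i)).symm y)) (-V)
          (extChartAt 𝓘(ℝ, E) (x i) (x i)) ∧
        HasFDerivAt (fun y => dist (x (i + 1)) ((extChartAt 𝓘(ℝ, E) (x i)).symm y)) V
          (extChartAt 𝓘(ℝ, E) (x i) (x i)) := by
      intro i
      obtain ⟨-, u, v, hu, hv, huv⟩ := h i
      obtain ⟨L, hL, huL⟩ := hu.exists_hasFDerivAt
      obtain ⟨V, hV, hvV⟩ := hv.exists_hasFDerivAt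
      refine ⟨V, ?_, hV⟩
      convert hL using 1
      refine ContinuousLinearMap.ext fun w => ?_
      have e1 := huL w
      have e2 := hvV w
      have e3 : inner ℝ (-v) w = -inner ℝ v w := inner_neg_left v w
      rw [huv, e3, e2] at e1
      exact e1
    choose V hV1 hV2 using hV
    have hjoint : ∀ i, HasFDerivAt (fun z : E × E => dist ((extChartAt 𝓘(ℝ, E) (x i)).symm z.1)
        ((extChartAt 𝓘(ℝ, E) (x (i + 1))).symm z.2)) ((V i).coprod (-V (i + 1)))
        (extChartAt 𝓘(ℝ, E) (x i) (x i), extChartAt 𝓘(ℝ, E) (x (i + 1)) (x (i + 1))) := by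
      intro i
      have hne : x i ≠ x (i + 1) := dist_ne_zero.mp (by rw [hdall]; exact hd)
      refine (midpointSemiconcaveAt_dist hne).hasFDerivAt_of_partial ?_ ?_
      · simp only [extChartAt_to_inv]
        simpa only [dist_comm] using hV2 i
      · simp only [extChartAt_to_inv]
        simpa only [add_sub_cancel_right] using hV1 (i + 1)
    let pr : Fin k → (Fin k → E) →L[ℝ] E × E := fun i =>
      (ContinuousLinearMap.proj (R := ℝ) (φ := fun _ : Fin k => E) i).prod
        (ContinuousLinearMap.proj (i + 1))
    have hsum : HasFDerivAt (fun y : Fin k → E => (k : ℝ) * ∑ i,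
        dist ((extChartAt 𝓘(ℝ, E) (x i)).symm (y i))
          ((extChartAt 𝓘(ℝ, E) (x (i + 1))).symm (y (i + 1))) ^ 2)
        ((k : ℝ) • ∑ i, (2 * d) • ((V i).coprod (-V (i + 1))).comp (pr i))
        (fun i => extChartAt 𝓘(ℝ, E) (x i) (x i)) := by
      refine HasFDerivAt.const_mul (HasFDerivAt.fun_sum fun i _ => ?_) _
      have hc := (HasFDerivAt.comp (fun i => extChartAt 𝓘(ℝ, E) (x i) (x i)) (hjoint i)
        (pr i).hasFDerivAt).real_sq
      have hval : dist ((extChartAt 𝓘(ℝ, E) (x i)).symm (extChartAt 𝓘(ℝ, E) (x i) (x i)))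
          ((extChartAt 𝓘(ℝ, E) (x (i + 1))).symm
            (extChartAt 𝓘(ℝ, E) (x (i + 1)) (x (i + 1)))) = d := by
        rw [extChartAt_to_inv, extChartAt_to_inv, hdall]
      rw [← hval]
      exact hc
    have hfun : (fun y : Fin k → E => uniformEnergy fun i =>
        (extChartAt 𝓘(ℝ, E) (x i)).symm (y i)) = fun y : Fin k → E => (k : ℝ) * ∑ i,
        dist ((extChartAt 𝓘(ℝ, E) (x i)).symm (y i))
          ((extChartAt 𝓘(ℝ, E) (x (i + 1))).symm (y (i + 1))) ^ 2 := by
      funext y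
      exact uniformEnergy_eq_mul_sum _
    rw [hfun]
    convert hsum using 1
    -- each derivative occurs twice, with opposite signs, after a cyclic shift of the indices
    refine ContinuousLinearMap.ext fun w => ?_
    have hshift : ∑ i, V (i + 1) (w (i + 1)) = ∑ i, V i (w i) :=
      Equiv.sum_comp (Equiv.addRight (1 : Fin k)) fun i => V i (w i)
    simp [pr, ← Finset.mul_sum, Finset.sum_add_distrib, hshift]
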